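/- Let $\mathbb D=\{z\in\mathbb C:|z|<1\}$ and let $\mathcal A$ be the class of analytic functions $f$ on $\mathbb D$ with $f(0)=0$, $f'(0)=1$. Let $$\mathcal K_3=\Big\{f\in\mathcal A:\ \operatorname{Re}\Big(\frac{1-z^2}{z}f(z)\Big)>0\ \text{ on }\mathbb D\Big\}.$$ For analytic $F,h$ on $\mathbb D$ write $F\prec h$ if $F=h\circ w$ for some analytic $w:\mathbb D\to\mathbb D$ with $w(0)=0$, and let $\mathcal S^*(h)=\{f\in\mathcal A: zf'(z)/f(z)\prec h(z)\}$. With principal square roots put $\mathcal S^*(\alpha)=\mathcal S^*\big(\tfrac{1+(1-2\alpha)z}{1-z}\big)$ for $0\le\alpha<1$; $\mathcal S^*_L=\mathcal S^*(\sqrt{1+z})$; $\mathcal S^*_e=\mathcal S^*(e^z)$; $\mathcal S^*_c=\mathcal S^*(1+\tfrac43z+\tfrac23z^2)$; $\mathcal S^*_{\leftmoon}=\mathcal S^*(z+\sqrt{1+z^2})$; $\mathcal S^*_{\sin}=\mathcal S^*(1+\sin z)$; $\mathcal S^*_R=\mathcal S^*\big(1+\tfrac{kz+z^2}{k^2-kz}\big)$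 with $k=\sqrt2+1$; $\mathcal S^*_{RL}=\mathcal S^*\Big(\sqrt2-(\sqrt2-1)\sqrt{\tfrac{1-z}{1+2(\sqrt2-1)z}}\Big)$; and let $\mathcal S_P$ be the class of $f\in\mathcal A$ for which $w=zf'(z)/f(z)$ satisfies $(\operatorname{Im}w)^2<2\operatorname{Re}w-1$ on $\mathbb D$. For $0<r\le1$ put $f_r(z)=f(rz)/r$. The (sharp) $\mathcal H$-radius of $\mathcal K_3$ is the largest $\rho\le1$ such that $f_r\in\mathcal H$ for all $f\in\mathcal K_3$ and all $0<r\le\rho$. A function $f_0\in\mathcal K_3$ is called extremal for it if $(f_0)_r\notin\mathcal H$ for every $r$ with $\rho<r\le1$. Let $$f_3(z)=\frac{z(1+iz)}{(1-z^2)(1-iz)},\qquad \hat f_3(z)=\frac{z}{(1+z)^2}.$$ **Theorem.** For every $f\in\mathcal K_3$ and $|z|=r<1$ (the quotient being $1$ at $z=0$), $$\left|\frac{zf'(z)}{f(z)}-\frac{1+r^4}{1-r^4}\right|\le\frac{2r(r^2+r+1)}{1-r^4}.$$ Moreover the following hold for the class $\mathcal K_3$. 1. For $0\le\alpha<1$ the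 sharp $\mathcal S^*(\alpha)$-radius is the smallest positive root of $(1+\alpha)r^4-2r(r^2+r+1)+(1-\alpha)=0$; $f_3$ is extremal. 2. The sharp $\mathcal S^*_L$-radius is $(\sqrt2-1)/(\sqrt2+1)\approx0.171573$; $\hat f_3$ is extremal. 3. The sharp $\mathcal S_P$-radius is the smallest positive root of $4r^3+4r^2+4r-1-3r^4=0$, $\approx0.2021347$; $f_3$ is extremal. 4. The sharp $\mathcal S^*_e$-radius is the smallest positive root of $(2r^3+2r^2+2r-1-r^4)e+1-r^4=0$, $\approx0.244259$; $f_3$ is extremal. 5. The sharp $\mathcal S^*_c$-radius is the smallest positive root of $3r^3+3r^2+3r-1-2r^4=0$, $\approx0.254726$; $f_3$ is extremal. 6. The sharp $\mathcal S^*_{\leftmoon}$-radius is the smallest positive root of $2r^3+2r^2+2r-\sqrt2\,r^4=2-\sqrt2$, $\approx0.229877$; $f_3$ is extremal. 7. The sharp $\mathcal S^*_{\sin}$-radius is $\sin1/(2+\sin1)\approx0.296139$; $\hat f_3$ is extremal. 8. The sharp $\mathcal S^*_R$-radius is the smallest positive root of $r^4+2r^3+2r^2+2r-3+2\sqrt2(1-r^4)=0$,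 $\approx0.0790749$; $f_3$ is extremal. 9. (No sharpness claimed.) Let $R_{RL}\approx0.125145$ be the smallest positive root of $$(1-r^4)\sqrt{(1-r^4)^2-\big((\sqrt2-1)-(\sqrt2+1)r^4\big)^2}=(2r^3+2r^2+2r)^2+(1-r^4)^2-\big((\sqrt2-1)-(\sqrt2+1)r^4\big)^2 .$$ Then $f_r\in\mathcal S^*_{RL}$ for every $f\in\mathcal K_3$ and every $0<r\le R_{RL}$. Each "$\approx$" means that the decimal shown is correct to within half a unit in its last digit. -/

import Mathlib

/-- The open unit disk of the complex plane. -/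
def diskD : Set ℂ := Metric.ball 0 1

/-- The class `𝒜`: functions analytic on the open unit disk with `f 0 = 0`, `f' 0 = 1`.
(Values outside the disk are irrelevant.) -/
def classA : Set (ℂ → ℂ) :=
  {f | DifferentiableOn ℂ f diskD ∧ f 0 = 0 ∧ deriv f 0 = 1}

/-- The function `z f'(z) / f(z)`, with its value `1` at the removable singularity `z = 0`. -/
noncomputable def starQuot (f : ℂ → ℂ) : ℂ → ℂ :=
  Function.update (fun z => z * deriv f z / f z) 0 1

/-- `F ≺ h`: both are analytic on the disk and `F = h ∘ w` there, for an analytic self-map `w`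
of the disk with `w 0 = 0`. -/
def SubordinateTo (F h : ℂ → ℂ) : Prop :=
  DifferentiableOn ℂ F diskD ∧ DifferentiableOn ℂ h diskD ∧
    ∃ w : ℂ → ℂ, DifferentiableOn ℂ w diskD ∧ Set.MapsTo w diskD diskD ∧ w 0 = 0 ∧
      ∀ z ∈ diskD, F z = h (w z)

/-- The class `𝒮*(h)` of all `f ∈ 𝒜` with `z f'(z) / f(z) ≺ h`; for the quotient to make sense
`f` has no zero in the punctured disk. -/
def starClass (h : ℂ → ℂ) : Set (ℂ → ℂ) :=
  {f | f ∈ classA ∧ (∀ z ∈ diskD, z ≠ 0 → f z ≠ 0) ∧ SubordinateTo (starQuot f) h}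

/-- Starlike functions of order `α`. -/
noncomputable def classSOrder (α : ℝ) : Set (ℂ → ℂ) :=
  starClass (fun z => (1 + (1 - 2 * (α : ℂ)) * z) / (1 - z))

/-- Lemniscate starlike functions, `h(z) = √(1 + z)` (principal branch). -/
noncomputable def classSL : Set (ℂ → ℂ) :=
  starClass (fun z => (1 + z) ^ (1 / 2 : ℂ))

/-- Parabolic starlike functions: `z f'(z) / f(z)` lies in `(Im w)² < 2 Re w - 1`. -/
noncomputable def classSP : Set (ℂ → ℂ) :=
  {f | f ∈ classA ∧ (∀ z ∈ diskD, z ≠ 0 → f z ≠ 0) ∧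
    ∀ z ∈ diskD, (starQuot f z).im ^ 2 < 2 * (starQuot f z).re - 1}

/-- Exponential starlike functions, `h(z) = e ^ z`. -/
noncomputable def classSE : Set (ℂ → ℂ) := starClass Complex.exp

/-- Starlike functions for the cardioid, `h(z) = 1 + 4 z / 3 + 2 z² / 3`. -/
noncomputable def classSC : Set (ℂ → ℂ) :=
  starClass (fun z => 1 + (4 / 3) * z + (2 / 3) * z ^ 2)

/-- Starlike functions for the lune, `h(z) = z + √(1 + z²)` (principal branch). -/
noncomputable def classSMoon : Set (ℂ → ℂ) :=
  starClass (fun z => z + (1 + z ^ 2) ^ (1 / 2 : ℂ))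

/-- Starlike functions for the sine, `h(z) = 1 + sin z`. -/
noncomputable def classSSin : Set (ℂ → ℂ) := starClass (fun z => 1 + Complex.sin z)

/-- Starlike functions for `h(z) = 1 + (k z + z²) / (k² - k z)` with `k = √2 + 1`. -/
noncomputable def classSR : Set (ℂ → ℂ) :=
  starClass (fun z =>
    1 + (z * ((√2 + 1 : ℝ) : ℂ) + z ^ 2) /
      (((√2 + 1 : ℝ) : ℂ) ^ 2 - ((√2 + 1 : ℝ) : ℂ) * z))

/-- Starlike functions for the left half of a shifted lemniscate,
`h(z) = √2 - (√2 - 1) √((1 - z) / (1 + 2 (√2 - 1) z))` (principal branch). -/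
noncomputable def classSRL : Set (ℂ → ℂ) :=
  starClass (fun z =>
    ((√2 : ℝ) : ℂ) - ((√2 - 1 : ℝ) : ℂ) *
      ((1 - z) / (1 + 2 * ((√2 - 1 : ℝ) : ℂ) * z)) ^ (1 / 2 : ℂ))

/-- The class `𝒦₃`: all `f ∈ 𝒜` with `Re ((1 - z²) f(z) / z) > 0` on the disk. At the removable
singularity `z = 0` the expression has the value `f' 0 = 1`, so nothing is required there. -/
def classK3 : Set (ℂ → ℂ) :=
  {f | f ∈ classA ∧ ∀ z ∈ diskD, z ≠ 0 → 0 < ((1 - z ^ 2) / z * f z).re}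

/-- The function `f_r(z) = f(r z) / r`. -/
noncomputable def dilate (r : ℝ) (f : ℂ → ℂ) : ℂ → ℂ := fun z => f (r * z) / r

/-- All `f ∈ G` satisfy `f_r ∈ H` for every `0 < r ≤ ρ`. -/
def DilatesInto (H G : Set (ℂ → ℂ)) (ρ : ℝ) : Prop :=
  ∀ f ∈ G, ∀ r : ℝ, 0 < r → r ≤ ρ → dilate r f ∈ H

/-- `R` is the (sharp) `H`-radius of `G`: the largest `ρ ≤ 1` such that `f ∈ G` implies
`f_r ∈ H` for all `0 < r ≤ ρ`. -/
def IsClassRadius (H G : Set (ℂ → ℂ)) (R : ℝ) : Prop :=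
  IsGreatest {ρ : ℝ | 0 ≤ ρ ∧ ρ ≤ 1 ∧ DilatesInto H G ρ} R

/-- `f₀ ∈ G` shows that `R` cannot be enlarged: `(f₀)_r ∉ H` for every `R < r ≤ 1`. -/
def IsExtremalAt (H G : Set (ℂ → ℂ)) (R : ℝ) (f₀ : ℂ → ℂ) : Prop :=
  f₀ ∈ G ∧ ∀ r : ℝ, R < r → r ≤ 1 → dilate r f₀ ∉ H

/-- `R` is the smallest positive real number satisfying the equation `eq`. -/
def IsLeastPosRoot (eq : ℝ → Prop) (R : ℝ) : Prop := IsLeast {r : ℝ | 0 < r ∧ eq r} R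

/-- The function `z (1 + i z) / ((1 - z²) (1 - i z))`. -/
noncomputable def extremalF3 : ℂ → ℂ :=
  fun z => z * (1 + Complex.I * z) / ((1 - z ^ 2) * (1 - Complex.I * z))

/-- The function `z / (1 + z)²`. -/
noncomputable def extremalKoebe : ℂ → ℂ := fun z => z / (1 + z) ^ 2

/-! A function of the class is `z p / (1 - z²)` with `Re p > 0`, so `z f' / f` equals `(1 + z²) / (1
- z²)` plus `z p' / p`. On `|z| = r` the first term lies on a circle with centre `c = (1 + r⁴) / (1
- r⁴)` and radius `2r² / (1 - r⁴)`, and Schwarz–Pick bounds the second by `2r / (1 - r²)`. Together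
they give the disk of `norm_starQuot_sub_le`, of radius `a` say.

A lower bound for a radius therefore amounts to placing this disk inside the region `h(𝔻)`.
`dilatesInto_starClass` asks for this in the form of an analytic inverse `g` of `h`, with `|g| < 1`
on the disk; the Schwarz function is then `g` composed with the quotient. The parabolic class is
defined by its region and is checked directly.

Since `c ≥ 1` stays close to `1` for the radii in question, one real boundary point of the region is
decisive. For the lemniscate and the sine it is the rightmost one, compared with `c + a = (1 + r) /
(1 - r)`; for the other sharp radii it is the leftmost one, `m`, and `c - a = m` is the polynomial
equation treated in `exists_leftRadius`. The work specific to each region is to show that this one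
inequality suffices for the whole disk.

Sharpness holds because `extremalF3` attains `c - a` and `extremalKoebe` attains `c + a` on every
circle, while the region contains no real value beyond the decisive point
(`isExtremalAt_of_starQuot`). For the reverse lemniscate only containment is proved, with a disk
inscribed about `c`. -/

/-! ### Schwarz–Pick for the half-plane -/

/-- **Schwarz–Pick** for maps of the disk into the right half-plane. -/
theorem norm_deriv_mul_le_of_re_pos {p : ℂ → ℂ} (hp : DifferentiableOn ℂ p diskD)
    (hre : ∀ z ∈ diskD, 0 < (p z).re) {z : ℂ} (hz : z ∈ diskD) :
    ‖deriv p z‖ * (1 - ‖z‖ ^ 2) ≤ 2 * (p z).re := by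
  have hz1 : ‖z‖ < 1 := by simpa [diskD] using hz
  set z' : ℂ := (starRingEnd ℂ) z with hz'
  set q' : ℂ := (starRingEnd ℂ) (p z) with hq'
  have hden : ∀ ζ ∈ diskD, 1 + z' * ζ ≠ 0 := by
    intro ζ hζ h
    have hζ1 : ‖ζ‖ < 1 := by simpa [diskD] using hζ
    have h1 : ‖z' * ζ‖ = 1 := by
      rw [eq_neg_of_add_eq_zero_right h]; simp
    rw [norm_mul, hz', Complex.norm_conj] at h1
    nlinarith [norm_nonneg z, norm_nonneg ζ]
  have hτ : ∀ ζ ∈ diskD, (ζ + z) / (1 + z' * ζ) ∈ diskD := by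
    intro ζ hζ
    have hζ1 : ‖ζ‖ < 1 := by simpa [diskD] using hζ
    have h0 : 0 < ‖1 + z' * ζ‖ := norm_pos_iff.2 (hden ζ hζ)
    simp only [diskD, Metric.mem_ball, dist_zero_right, norm_div]
    rw [div_lt_one h0]
    refine lt_of_pow_lt_pow_left₀ 2 h0.le ?_
    have e1 : ‖1 + z' * ζ‖ ^ 2 - ‖ζ + z‖ ^ 2 = (1 - ‖z‖ ^ 2) * (1 - ‖ζ‖ ^ 2) := by
      simp only [← Complex.normSq_eq_norm_sq, Complex.normSq_apply, hz']
      simp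
      ring
    nlinarith [mul_pos (show 0 < 1 - ‖z‖ ^ 2 by nlinarith [norm_nonneg z])
      (show 0 < 1 - ‖ζ‖ ^ 2 by nlinarith [norm_nonneg ζ])]
  have hden2 : ∀ v ∈ diskD, p v + q' ≠ 0 := by
    intro v hv h
    have := congrArg Complex.re h
    simp [hq'] at this
    linarith [hre v hv, hre z hz]
  -- The automorphism `τ` carries `0` to `z`, and a Cayley transform carries `p z` to `0`. The
  -- resulting self-map `φ` of the disk fixes `0`, and `φ'(0) = p'(z) (1 - |z|²) / (2 Re p(z))`.
  set τ : ℂ → ℂ := fun ζ => (ζ + z) / (1 + z' * ζ) with hτdef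
  set φ : ℂ → ℂ := fun ζ => (p (τ ζ) - p z) / (p (τ ζ) + q') with hφdef
  have hτd : DifferentiableOn ℂ τ diskD := by
    apply DifferentiableOn.div (by fun_prop) (by fun_prop) hden
  have hpτ : DifferentiableOn ℂ (fun ζ => p (τ ζ)) diskD := hp.comp hτd hτ
  have hφd : DifferentiableOn ℂ φ diskD :=
    DifferentiableOn.div (hpτ.sub_const _) (hpτ.add_const _) (fun ζ hζ => hden2 _ (hτ ζ hζ))
  have hτ0 : τ 0 = z := by simp [hτdef]
  have hφ0 : φ 0 = 0 := by simp [hφdef, hτ0]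
  have hmap : Set.MapsTo φ (Metric.ball 0 1) (Metric.ball (φ 0) 1) := by
    intro ζ hζ
    have hv := hre _ (hτ ζ hζ)
    have h0 : 0 < ‖p (τ ζ) + q'‖ := norm_pos_iff.2 (hden2 _ (hτ ζ hζ))
    rw [hφ0]
    simp only [Metric.mem_ball, dist_zero_right, hφdef, norm_div]
    rw [div_lt_one h0]
    refine lt_of_pow_lt_pow_left₀ 2 h0.le ?_
    have e1 : ‖p (τ ζ) + q'‖ ^ 2 - ‖p (τ ζ) - p z‖ ^ 2 = 4 * (p (τ ζ)).re * (p z).re := by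
      simp only [← Complex.normSq_eq_norm_sq, Complex.normSq_apply, hq']
      simp
      ring
    nlinarith [mul_pos hv (hre z hz)]
  have hle := Complex.norm_deriv_le_one_of_mapsTo_ball (f := φ) (c := 0) (R := 1) hφd
    (fun x hx => Metric.ball_subset_closedBall (hmap hx)) one_pos
  have dτ : HasDerivAt τ (1 - z' * z) 0 := by
    have := ((hasDerivAt_id (0 : ℂ)).add_const z).div
      (((hasDerivAt_id (0 : ℂ)).const_mul z').const_add 1) (by simp)
    refine this.congr_deriv ?_
    simp [mul_comm]
  have dp : HasDerivAt p (deriv p z) (τ 0) := by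
    rw [hτ0]
    exact (hp.differentiableAt (Metric.isOpen_ball.mem_nhds hz)).hasDerivAt
  have dpτ : HasDerivAt (fun ζ => p (τ ζ)) (deriv p z * (1 - z' * z)) 0 := dp.comp 0 dτ
  have dφ := (dpτ.sub_const (p z)).div (dpτ.add_const q') (by rw [hτ0]; exact hden2 z hz)
  have e2 : deriv φ 0 = deriv p z * (1 - z' * z) / (p z + q') := by
    have : deriv φ 0 = _ := dφ.deriv
    rw [this]
    simp only [hτ0, sub_self, zero_mul, sub_zero]
    have := hden2 z hz
    field_simp
  have e3 : p z + q' = ((2 * (p z).re : ℝ) : ℂ) := by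
    rw [hq', Complex.add_conj]
  have e4 : 1 - z' * z = ((1 - ‖z‖ ^ 2 : ℝ) : ℂ) := by
    rw [hz', mul_comm, Complex.mul_conj, Complex.normSq_eq_norm_sq]; push_cast; ring
  rw [e2, e3, e4, norm_div, norm_mul, Complex.norm_real, Complex.norm_real,
    Real.norm_of_nonneg (by nlinarith [norm_nonneg z] : (0:ℝ) ≤ 1 - ‖z‖ ^ 2),
    Real.norm_of_nonneg (by linarith [hre z hz] : (0:ℝ) ≤ 2 * (p z).re),
    div_le_one (by linarith [hre z hz])] at hle
  exact hle

/-! ### The disk containing the quotient -/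

theorem mem_diskD {z : ℂ} : z ∈ diskD ↔ ‖z‖ < 1 := by simp [diskD]

theorem isOpen_diskD : IsOpen diskD := Metric.isOpen_ball

theorem one_sub_sq_ne_zero {z : ℂ} (hz : z ∈ diskD) : 1 - z ^ 2 ≠ 0 := by
  intro h
  have h1 : ‖z ^ 2‖ = 1 := by rw [← sub_eq_zero.1 h]; simp
  rw [norm_pow] at h1
  nlinarith [norm_nonneg z, mem_diskD.1 hz]

/-- The centre of the disk containing `z f'(z) / f(z)` for `f ∈ 𝒦₃` and `|z| = s`. -/
noncomputable def diskCenter (s : ℝ) : ℝ := (1 + s ^ 4) / (1 - s ^ 4)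

/-- The radius of the disk containing `z f'(z) / f(z)` for `f ∈ 𝒦₃` and `|z| = s`. -/
noncomputable def diskRadius (s : ℝ) : ℝ := 2 * s * (s ^ 2 + s + 1) / (1 - s ^ 4)

theorem one_sub_pow_four_pos {s : ℝ} (h0 : 0 ≤ s) (h1 : s < 1) : 0 < 1 - s ^ 4 :=
  sub_pos.2 (pow_lt_one₀ h0 h1 (by norm_num))

theorem one_le_diskCenter {s : ℝ} (h0 : 0 ≤ s) (h1 : s < 1) : 1 ≤ diskCenter s := by
  rw [diskCenter, le_div_iff₀ (one_sub_pow_four_pos h0 h1)]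
  nlinarith [pow_nonneg h0 4]

theorem diskRadius_nonneg {s : ℝ} (h0 : 0 ≤ s) (h1 : s < 1) : 0 ≤ diskRadius s :=
  div_nonneg (by positivity) (one_sub_pow_four_pos h0 h1).le

theorem diskCenter_add_diskRadius {s : ℝ} (h0 : 0 ≤ s) (h1 : s < 1) :
    diskCenter s + diskRadius s = (1 + s) / (1 - s) := by
  have h2 := (one_sub_pow_four_pos h0 h1).ne'
  have h3 : 1 - s ≠ 0 := by linarith
  rw [diskCenter, diskRadius]
  field_simp
  ring

theorem diskCenter_sub_diskRadius (s : ℝ) :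
    diskCenter s - diskRadius s = (1 + s ^ 4 - 2 * s * (s ^ 2 + s + 1)) / (1 - s ^ 4) := by
  rw [diskCenter, diskRadius, ← sub_div]

/-- A function `f = z p / (1 - z²)` has `z f' / f = (1 + z²) / (1 - z²) + z p' / p`. -/
theorem starQuot_eq {f p : ℂ → ℂ} (hp : DifferentiableOn ℂ p diskD)
    (hp0 : ∀ z ∈ diskD, p z ≠ 0) (hf : ∀ z ∈ diskD, f z = z * p z / (1 - z ^ 2))
    {z : ℂ} (hz : z ∈ diskD) :
    starQuot f z = (1 + z ^ 2) / (1 - z ^ 2) + z * deriv p z / p z := by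
  rcases eq_or_ne z 0 with rfl | h0
  · simp [starQuot]
  have h1 := one_sub_sq_ne_zero hz
  have h2 := hp0 z hz
  have dp : HasDerivAt p (deriv p z) z :=
    (hp.differentiableAt (isOpen_diskD.mem_nhds hz)).hasDerivAt
  have d1 := ((hasDerivAt_id z).mul dp).div (((hasDerivAt_id z).pow 2).const_sub 1) h1
  have hev : f =ᶠ[nhds z] fun z => z * p z / (1 - z ^ 2) := by
    filter_upwards [isOpen_diskD.mem_nhds hz] with w hw using hf w hw
  have d2 : deriv f z = _ := hev.deriv_eq.trans d1.deriv
  rw [starQuot, Function.update_of_ne h0, d2, hf z hz]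
  simp only [id, Pi.mul_apply, Pi.pow_apply]
  field_simp
  push_cast
  ring

/-- `dslope` fills the removable singularity of `f z / z`, giving `p` the value `1` at the origin.
-/
theorem exists_factor_of_mem_classK3 {f : ℂ → ℂ} (hf : f ∈ classK3) :
    ∃ p : ℂ → ℂ, DifferentiableOn ℂ p diskD ∧ (∀ z ∈ diskD, 0 < (p z).re) ∧
      ∀ z ∈ diskD, f z = z * p z / (1 - z ^ 2) := by
  obtain ⟨⟨hd, h0, h1⟩, hre⟩ := hf
  have hm : diskD ∈ nhds (0 : ℂ) := Metric.ball_mem_nhds 0 one_pos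
  have key : ∀ z ≠ 0, dslope f 0 z = f z / z := by
    intro z hz
    rw [dslope_of_ne _ hz, slope_def_field, h0, sub_zero, sub_zero]
  refine ⟨fun z => (1 - z ^ 2) * dslope f 0 z, ?_, ?_, ?_⟩
  · exact DifferentiableOn.mul (by fun_prop) ((Complex.differentiableOn_dslope hm).2 hd)
  · intro z hz
    rcases eq_or_ne z 0 with rfl | hz0
    · simp [h1]
    · have := hre z hz hz0
      beta_reduce
      rwa [key z hz0, mul_div_assoc', ← div_mul_eq_mul_div]
  · intro z hz
    have h2 := one_sub_sq_ne_zero hz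
    rcases eq_or_ne z 0 with rfl | hz0
    · simp [h0]
    · simp only [key z hz0]
      field_simp

/-- With `u = z²` the difference has numerator `2 (u - |u|²) = 2u (1 - ū)`, of modulus `2 |u| |1 -
u|`. The factor `|1 - u|` cancels, so equality holds. -/
theorem norm_mobius_sq_sub_le {z : ℂ} (hz : z ∈ diskD) :
    ‖(1 + z ^ 2) / (1 - z ^ 2) - (diskCenter ‖z‖ : ℂ)‖ ≤ 2 * ‖z‖ ^ 2 / (1 - ‖z‖ ^ 4) := by
  have h1 := one_sub_sq_ne_zero hz
  have hz1 := mem_diskD.1 hz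
  have h4 := one_sub_pow_four_pos (norm_nonneg z) hz1
  have h4' : (1 - (‖z‖ : ℂ) ^ 4) ≠ 0 := by exact_mod_cast h4.ne'
  set u := z ^ 2 with hu
  have hun : ‖u‖ = ‖z‖ ^ 2 := by rw [hu, norm_pow]
  have e : (1 + u) / (1 - u) - (diskCenter ‖z‖ : ℂ) =
      2 * (u - (‖z‖ : ℂ) ^ 4) / ((1 - u) * (1 - (‖z‖ : ℂ) ^ 4)) := by
    rw [diskCenter]
    push_cast
    field_simp
    ring
  have e2 : ‖u - (‖z‖ : ℂ) ^ 4‖ = ‖z‖ ^ 2 * ‖1 - u‖ := by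
    have e3 : (‖z‖ : ℂ) ^ 4 = u * (starRingEnd ℂ) u := by
      rw [Complex.mul_conj, Complex.normSq_eq_norm_sq, hun]; push_cast; ring
    rw [e3, show u - u * (starRingEnd ℂ) u = u * (starRingEnd ℂ) (1 - u) by simp; ring,
      norm_mul, Complex.norm_conj, hun]
  have e5 : ‖1 - (‖z‖ : ℂ) ^ 4‖ = 1 - ‖z‖ ^ 4 := by
    rw [← Complex.ofReal_pow, ← Complex.ofReal_one, ← Complex.ofReal_sub, Complex.norm_real,
      Real.norm_of_nonneg h4.le]
  rw [e, norm_div, norm_mul, norm_mul, e2, e5]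
  have : ‖1 - u‖ ≠ 0 := norm_ne_zero_iff.2 h1
  apply le_of_eq
  simp
  field_simp

/-- Since `Re p ≤ |p|`, Schwarz–Pick bounds `|z p' / p|` by `2r / (1 - r²)`; adding `2r² / (1 - r⁴)`
gives the radius. -/
theorem norm_starQuot_sub_le {f : ℂ → ℂ} (hf : f ∈ classK3) {z : ℂ} (hz : z ∈ diskD) :
    ‖starQuot f z - (diskCenter ‖z‖ : ℂ)‖ ≤ diskRadius ‖z‖ := by
  obtain ⟨p, hp, hre, hfp⟩ := exists_factor_of_mem_classK3 hf
  have hp0 : ∀ z ∈ diskD, p z ≠ 0 := fun z hz h => by simpa [h] using hre z hz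
  have hz1 := mem_diskD.1 hz
  have h4 := one_sub_pow_four_pos (norm_nonneg z) hz1
  have hpz : 0 < ‖p z‖ := norm_pos_iff.2 (hp0 z hz)
  have h2 : 0 < 1 - ‖z‖ ^ 2 := by nlinarith [norm_nonneg z]
  have b1 := norm_mobius_sq_sub_le hz
  have b2 : ‖z * deriv p z / p z‖ ≤ 2 * ‖z‖ / (1 - ‖z‖ ^ 2) := by
    have b3 := norm_deriv_mul_le_of_re_pos hp hre hz
    have b4 := Complex.re_le_norm (p z)
    rw [norm_div, norm_mul, div_le_div_iff₀ hpz h2]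
    nlinarith [norm_nonneg z, mul_le_mul_of_nonneg_left (b3.trans (by linarith : _ ≤ 2 * ‖p z‖))
      (norm_nonneg z)]
  rw [starQuot_eq hp hp0 hfp hz, add_sub_right_comm]
  refine (norm_add_le _ _).trans ((add_le_add b1 b2).trans (le_of_eq ?_))
  rw [diskRadius]
  rw [show 1 - ‖z‖ ^ 4 = (1 - ‖z‖ ^ 2) * (1 + ‖z‖ ^ 2) by ring]
  have : 1 + ‖z‖ ^ 2 ≠ 0 := by positivity
  field_simp
  ring

theorem differentiableOn_starQuot {f : ℂ → ℂ} (hf : f ∈ classK3) :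
    DifferentiableOn ℂ (starQuot f) diskD := by
  obtain ⟨p, hp, hre, hfp⟩ := exists_factor_of_mem_classK3 hf
  have hp0 : ∀ z ∈ diskD, p z ≠ 0 := fun z hz h => by simpa [h] using hre z hz
  refine DifferentiableOn.congr (f := fun z => (1 + z ^ 2) / (1 - z ^ 2) + z * deriv p z / p z) ?_
    (fun z hz => starQuot_eq hp hp0 hfp hz)
  have hp' := hp.deriv isOpen_diskD
  exact (DifferentiableOn.div (by fun_prop) (by fun_prop) fun z hz => one_sub_sq_ne_zero hz).add
    ((differentiableOn_id.mul hp').div hp hp0)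

theorem ne_zero_of_mem_classK3 {f : ℂ → ℂ} (hf : f ∈ classK3) {z : ℂ} (hz : z ∈ diskD)
    (hz0 : z ≠ 0) : f z ≠ 0 := by
  intro h
  simpa [h] using hf.2 z hz hz0

/-! ### Dilations, and criteria for radii and extremality -/

theorem mul_mem_diskD {r : ℝ} (h0 : 0 < r) (h1 : r ≤ 1) {z : ℂ} (hz : z ∈ diskD) :
    (r : ℂ) * z ∈ diskD := by
  rw [mem_diskD, norm_mul, Complex.norm_real, Real.norm_of_nonneg h0.le]
  nlinarith [mem_diskD.1 hz, norm_nonneg z]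

theorem deriv_dilate {r : ℝ} (h0 : 0 < r) (f : ℂ → ℂ) (z : ℂ) :
    deriv (dilate r f) z = deriv f (r * z) := by
  have hr : (r : ℂ) ≠ 0 := by exact_mod_cast h0.ne'
  unfold dilate
  rw [deriv_div_const, deriv_comp_mul_left (r : ℂ) f z, smul_eq_mul]
  field_simp

theorem dilate_mem_classA {r : ℝ} (h0 : 0 < r) (h1 : r ≤ 1) {f : ℂ → ℂ} (hf : f ∈ classA) :
    dilate r f ∈ classA := by
  obtain ⟨hd, hf0, hf1⟩ := hf
  refine ⟨?_, by simp [dilate, hf0], by rw [deriv_dilate h0]; simpa using hf1⟩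
  exact (hd.comp (f := fun z => (r : ℂ) * z) (by fun_prop)
    (fun z hz => mul_mem_diskD h0 h1 hz)).div_const _

theorem starQuot_dilate {r : ℝ} (h0 : 0 < r) (f : ℂ → ℂ) (z : ℂ) :
    starQuot (dilate r f) z = starQuot f (r * z) := by
  have hr : (r : ℂ) ≠ 0 := by exact_mod_cast h0.ne'
  rcases eq_or_ne z 0 with rfl | hz
  · simp [starQuot]
  · rw [starQuot, starQuot, Function.update_of_ne hz, Function.update_of_ne (mul_ne_zero hr hz),
      deriv_dilate h0, dilate]
    field_simp

theorem dilate_ne_zero {r : ℝ} (h0 : 0 < r) (h1 : r ≤ 1) {f : ℂ → ℂ} (hf : f ∈ classK3) {z : ℂ}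
    (hz : z ∈ diskD) (hz0 : z ≠ 0) : dilate r f z ≠ 0 := by
  have hr : (r : ℂ) ≠ 0 := by exact_mod_cast h0.ne'
  exact div_ne_zero (ne_zero_of_mem_classK3 hf (mul_mem_diskD h0 h1 hz) (mul_ne_zero hr hz0)) hr

/-- The values of `z f_r'(z) / f_r(z)` lie in one of the disks of radius `s < r`. -/
theorem exists_norm_starQuot_dilate_sub_le {r : ℝ} (h0 : 0 < r) (h1 : r ≤ 1) {f : ℂ → ℂ}
    (hf : f ∈ classK3) {z : ℂ} (hz : z ∈ diskD) : ∃ s, 0 ≤ s ∧ s < r ∧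
      ‖starQuot (dilate r f) z - (diskCenter s : ℂ)‖ ≤ diskRadius s := by
  have hs : ‖(r : ℂ) * z‖ = r * ‖z‖ := by
    rw [norm_mul, Complex.norm_real, Real.norm_of_nonneg h0.le]
  refine ⟨r * ‖z‖, by positivity, ?_, ?_⟩
  · nlinarith [mem_diskD.1 hz]
  · rw [starQuot_dilate h0, ← hs]
    exact norm_starQuot_sub_le hf (mul_mem_diskD h0 h1 hz)

/-- If `h` has an analytic inverse `g` with values in the unit disk on all the disks with
parameter `s < R`, then the `𝒮*(h)`-radius of `𝒦₃` is at least `R`. -/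
theorem dilatesInto_starClass {h g : ℂ → ℂ} {R : ℝ} (hR : R ≤ 1) (hh : DifferentiableOn ℂ h diskD)
    (hg1 : g 1 = 0)
    (hg : ∀ s, 0 ≤ s → s < R → ∀ w : ℂ, ‖w - (diskCenter s : ℂ)‖ ≤ diskRadius s →
      DifferentiableAt ℂ g w ∧ ‖g w‖ < 1 ∧ h (g w) = w) :
    DilatesInto (starClass h) classK3 R := by
  intro f hf r hr0 hrR
  have hr1 := hrR.trans hR
  have key : ∀ z ∈ diskD, DifferentiableAt ℂ g (starQuot (dilate r f) z) ∧
      ‖g (starQuot (dilate r f) z)‖ < 1 ∧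
      h (g (starQuot (dilate r f) z)) = starQuot (dilate r f) z := by
    intro z hz
    obtain ⟨s, hs0, hsr, hs⟩ := exists_norm_starQuot_dilate_sub_le hr0 hr1 hf hz
    exact hg s hs0 (hsr.trans_le hrR) _ hs
  have hF : DifferentiableOn ℂ (starQuot (dilate r f)) diskD := by
    have : starQuot (dilate r f) = fun z => starQuot f (r * z) :=
      funext fun z => starQuot_dilate hr0 f z
    rw [this]
    exact (differentiableOn_starQuot hf).comp (f := fun z => (r : ℂ) * z) (by fun_prop)
      (fun z hz => mul_mem_diskD hr0 hr1 hz)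
  refine ⟨dilate_mem_classA hr0 hr1 hf.1, fun z hz hz0 => dilate_ne_zero hr0 hr1 hf hz hz0,
    hF, hh, fun z => g (starQuot (dilate r f) z), ?_, ?_, ?_, ?_⟩
  · intro z hz
    exact (key z hz).1.comp_differentiableWithinAt z (hF z hz)
  · intro z hz
    exact mem_diskD.2 (key z hz).2.1
  · simp [starQuot, hg1]
  · intro z hz
    exact (key z hz).2.2.symm

theorem isClassRadius_of_isExtremalAt {H : Set (ℂ → ℂ)} {R : ℝ} {f₀ : ℂ → ℂ} (h0 : 0 ≤ R)
    (h1 : R ≤ 1) (hR : DilatesInto H classK3 R) (hf : IsExtremalAt H classK3 R f₀) :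
    IsClassRadius H classK3 R ∧ IsExtremalAt H classK3 R f₀ := by
  refine ⟨⟨⟨h0, h1, hR⟩, fun ρ ⟨_, hρ1, hρ⟩ => ?_⟩, hf⟩
  by_contra! hlt
  exact hf.2 ρ hlt hρ1 (hρ f₀ hf.1 ρ (h0.trans_lt hlt) le_rfl)

/-- If `f₀ ∈ 𝒦₃` takes, for each `s ∈ (R, 1)`, at some point of modulus `s` a value of
`z f₀' / f₀` that members of `H` cannot take, then `f₀` is extremal. -/
theorem isExtremalAt_of_starQuot {H : Set (ℂ → ℂ)} {R : ℝ} {f₀ : ℂ → ℂ} {v : ℝ → ℝ} (h0 : 0 ≤ R)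
    (hf : f₀ ∈ classK3)
    (hv : ∀ s, 0 < s → s < 1 → ∃ z : ℂ, ‖z‖ = s ∧ starQuot f₀ z = (v s : ℂ))
    (hH : ∀ s, R < s → s < 1 → ∀ f ∈ H, ∀ z ∈ diskD, starQuot f z ≠ (v s : ℂ)) :
    IsExtremalAt H classK3 R f₀ := by
  refine ⟨hf, fun r hRr hr1 hmem => ?_⟩
  have hr0 := h0.trans_lt hRr
  -- Taking `s` strictly below `r` puts `z / r` inside the open disk, which also covers `r = 1`.
  obtain ⟨s, hs1, hs2⟩ := exists_between hRr
  obtain ⟨z, hz, hzv⟩ := hv s (h0.trans_lt hs1) (hs2.trans_le hr1)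
  have hr : (r : ℂ) ≠ 0 := by exact_mod_cast hr0.ne'
  refine hH s hs1 (hs2.trans_le hr1) _ hmem (z / r) ?_ ?_
  · rw [mem_diskD, norm_div, Complex.norm_real, Real.norm_of_nonneg hr0.le, hz, div_lt_one hr0]
    exact hs2
  · rw [starQuot_dilate hr0, mul_div_cancel₀ z hr, hzv]

theorem starQuot_ne_of_mem_starClass {h f : ℂ → ℂ} {v : ℂ} (hv : ∀ t ∈ diskD, h t ≠ v)
    (hf : f ∈ starClass h) {z : ℂ} (hz : z ∈ diskD) : starQuot f z ≠ v := by
  obtain ⟨-, -, -, -, w, -, hw, -, he⟩ := hf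
  rw [he z hz]
  exact hv _ (hw hz)

/-! ### Explicit members of the class -/

/-- Functions `z p / (1 - z²)` with `p` of positive real part and `p 0 = 1` belong to `𝒦₃`. -/
theorem mem_classK3_of_factor {f p : ℂ → ℂ} (hp : DifferentiableOn ℂ p diskD)
    (hre : ∀ z ∈ diskD, 0 < (p z).re) (hp0 : p 0 = 1)
    (hf : ∀ z ∈ diskD, f z = z * p z / (1 - z ^ 2)) : f ∈ classK3 := by
  have h00 : (0 : ℂ) ∈ diskD := by simp [diskD]
  have hev : f =ᶠ[nhds 0] fun z => z * p z / (1 - z ^ 2) := by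
    filter_upwards [isOpen_diskD.mem_nhds h00] with w hw using hf w hw
  have dp : HasDerivAt p (deriv p 0) 0 :=
    (hp.differentiableAt (isOpen_diskD.mem_nhds h00)).hasDerivAt
  have d1 := ((hasDerivAt_id (0 : ℂ)).mul dp).div (((hasDerivAt_id (0 : ℂ)).pow 2).const_sub 1)
    (by simp)
  refine ⟨⟨?_, ?_, ?_⟩, ?_⟩
  · refine DifferentiableOn.congr ?_ hf
    exact (differentiableOn_id.mul hp).div (by fun_prop) fun z hz => one_sub_sq_ne_zero hz
  · simp [hf 0 h00]
  · rw [hev.deriv_eq]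
    refine d1.deriv.trans ?_
    simp [hp0]
  · intro z hz hz0
    have h1 := one_sub_sq_ne_zero hz
    rw [hf z hz, show (1 - z ^ 2) / z * (z * p z / (1 - z ^ 2)) = p z by field_simp]
    exact hre z hz

theorem re_div_pos {a b : ℂ} (h : 0 < a.re * b.re + a.im * b.im) : 0 < (a / b).re := by
  have hb : 0 < Complex.normSq b := by
    refine Complex.normSq_pos.2 fun h0 => ?_
    simp [h0] at h
  rw [Complex.div_re, ← add_div]
  positivity

theorem re_sq_add_im_sq_lt_one {z : ℂ} (hz : z ∈ diskD) : z.re ^ 2 + z.im ^ 2 < 1 := by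
  have h1 := mem_diskD.1 hz
  have h2 : ‖z‖ ^ 2 = z.re ^ 2 + z.im ^ 2 := by
    rw [← Complex.normSq_eq_norm_sq, Complex.normSq_apply]; ring
  nlinarith [norm_nonneg z]

theorem one_add_ne_zero {z : ℂ} (hz : z ∈ diskD) : 1 + z ≠ 0 := by
  intro h
  have := mem_diskD.1 hz
  rw [eq_neg_of_add_eq_zero_right h] at this
  simp at this

theorem one_sub_ne_zero {z : ℂ} (hz : z ∈ diskD) : 1 - z ≠ 0 := by
  intro h
  have := mem_diskD.1 hz
  rw [← sub_eq_zero.1 h] at this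
  simp at this

theorem I_mul_mem_diskD {z : ℂ} (hz : z ∈ diskD) : Complex.I * z ∈ diskD := by
  rw [mem_diskD] at *
  simpa using hz

theorem re_cayley_pos {z : ℂ} (hz : z ∈ diskD) : 0 < ((1 + z) / (1 - z)).re := by
  apply re_div_pos
  have := re_sq_add_im_sq_lt_one hz
  simp
  nlinarith

theorem differentiableOn_cayley : DifferentiableOn ℂ (fun z : ℂ => (1 + z) / (1 - z)) diskD :=
  DifferentiableOn.div (by fun_prop) (by fun_prop) fun _ hz => one_sub_ne_zero hz

theorem deriv_cayley_comp_mul {c z : ℂ} (hz : 1 - c * z ≠ 0) :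
    deriv (fun z : ℂ => (1 + c * z) / (1 - c * z)) z = 2 * c / (1 - c * z) ^ 2 := by
  have d := (((hasDerivAt_id z).const_mul c).const_add 1).div
    (((hasDerivAt_id z).const_mul c).const_sub 1) hz
  refine d.deriv.trans ?_
  simp only [id]
  congr 1
  ring

/-- The function `z (1 + c z) / ((1 - z²) (1 - c z))`, `|c| ≤ 1`, is in `𝒦₃`. -/
theorem cayley_factor {c : ℂ} (hc : ‖c‖ ≤ 1) {f : ℂ → ℂ}
    (hf : ∀ z ∈ diskD, f z = z * ((1 + c * z) / (1 - c * z)) / (1 - z ^ 2)) :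
    f ∈ classK3 ∧ ∀ z ∈ diskD,
      starQuot f z = (1 + z ^ 2) / (1 - z ^ 2) + 2 * c * z / (1 - (c * z) ^ 2) := by
  have hcz : ∀ z ∈ diskD, c * z ∈ diskD := by
    intro z hz
    rw [mem_diskD, norm_mul] at *
    nlinarith [norm_nonneg z, norm_nonneg c]
  have hre : ∀ z ∈ diskD, 0 < ((1 + c * z) / (1 - c * z)).re := fun z hz =>
    re_cayley_pos (hcz z hz)
  have hd : DifferentiableOn ℂ (fun z => (1 + c * z) / (1 - c * z)) diskD :=
    differentiableOn_cayley.comp (f := fun z => c * z) (by fun_prop) hcz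
  refine ⟨mem_classK3_of_factor hd hre (by simp) hf, fun z hz => ?_⟩
  have h1 := one_sub_ne_zero (hcz z hz)
  have h2 := one_add_ne_zero (hcz z hz)
  rw [starQuot_eq hd (fun z hz h => by simpa [h] using hre z hz) hf hz, deriv_cayley_comp_mul h1]
  congr 1
  rw [show 1 - (c * z) ^ 2 = (1 - c * z) * (1 + c * z) by ring]
  field_simp

/-- At `z = i s` both terms are at their leftmost: `z² = -s²` gives `(1 - s²) / (1 + s²)`, and `i z
= -s` gives `-2s / (1 - s²)`. -/
theorem extremalF3_mem_and_starQuot : extremalF3 ∈ classK3 ∧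
    ∀ s, 0 < s → s < 1 → ∃ z : ℂ, ‖z‖ = s ∧
      starQuot extremalF3 z = ((diskCenter s - diskRadius s : ℝ) : ℂ) := by
  have h := cayley_factor (c := Complex.I) (by simp) (f := extremalF3) (fun z hz => by
    have := one_sub_ne_zero (I_mul_mem_diskD hz)
    have := one_sub_sq_ne_zero hz
    rw [extremalF3]
    field_simp)
  refine ⟨h.1, fun s h0 h1 => ⟨Complex.I * s, by simp [abs_of_pos h0], ?_⟩⟩
  have hs : (Complex.I * (s : ℂ)) ∈ diskD := by
    rw [mem_diskD]; simpa [abs_of_pos h0] using h1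
  rw [h.2 _ hs, diskCenter_sub_diskRadius]
  have e1 : 1 - (s : ℂ) ^ 2 ≠ 0 := by
    have : 1 - s ^ 2 ≠ 0 := by nlinarith
    exact_mod_cast this
  have e2 : 1 + (s : ℂ) ^ 2 ≠ 0 := by
    have : 1 + s ^ 2 ≠ 0 := by positivity
    exact_mod_cast this
  push_cast
  rw [show (1 : ℂ) - (s : ℂ) ^ 4 = (1 - (s : ℂ) ^ 2) * (1 + (s : ℂ) ^ 2) by ring,
    show (Complex.I * (s : ℂ)) ^ 2 = -(s : ℂ) ^ 2 by rw [mul_pow, Complex.I_sq]; ring,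
    show Complex.I * (Complex.I * (s : ℂ)) = -s by rw [← mul_assoc, Complex.I_mul_I]; ring,
    show 2 * Complex.I * (Complex.I * (s : ℂ)) = -(2 * s) by
      rw [← mul_assoc, mul_assoc 2, Complex.I_mul_I]; ring,
    show (1 : ℂ) - (-(s : ℂ)) ^ 2 = 1 - (s : ℂ) ^ 2 by ring, sub_neg_eq_add]
  field_simp
  ring

/-- This is the choice `c = -1`. At `z = -s` both terms are at their rightmost, and the sum `(1 +
s)² / (1 - s²)` simplifies. -/
theorem extremalKoebe_mem_and_starQuot : extremalKoebe ∈ classK3 ∧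
    ∀ s, 0 < s → s < 1 → ∃ z : ℂ, ‖z‖ = s ∧
      starQuot extremalKoebe z = (((1 + s) / (1 - s) : ℝ) : ℂ) := by
  have h := cayley_factor (c := -1) (by simp) (f := extremalKoebe) (fun z hz => by
    have := one_add_ne_zero hz
    have := one_sub_ne_zero hz
    rw [extremalKoebe, show 1 - z ^ 2 = (1 - z) * (1 + z) by ring,
      show 1 - -1 * z = 1 + z by ring, show 1 + -1 * z = 1 - z by ring]
    field_simp)
  refine ⟨h.1, fun s h0 h1 => ⟨-(s : ℂ), by simp [abs_of_pos h0], ?_⟩⟩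
  have hs : -(s : ℂ) ∈ diskD := by
    rw [mem_diskD]; simpa [abs_of_pos h0] using h1
  rw [h.2 _ hs]
  have e1 := one_add_ne_zero hs
  have e2 := one_sub_ne_zero hs
  rw [← sub_eq_add_neg] at e1
  rw [sub_neg_eq_add] at e2
  push_cast
  rw [show (1 : ℂ) - (-(s : ℂ)) ^ 2 = (1 - s) * (1 + s) by ring,
    show (1 : ℂ) - (-1 * (-(s : ℂ))) ^ 2 = (1 - s) * (1 + s) by ring]
  field_simp
  ring

/-! ### Square roots, disk estimates and the leftmost-point equation -/

theorem re_cpow_half_pos {z : ℂ} (hz : z ∈ Complex.slitPlane) : 0 < (z ^ (1 / 2 : ℂ)).re := by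
  have h0 := Complex.slitPlane_ne_zero hz
  rw [Complex.cpow_def_of_ne_zero h0, Complex.exp_re]
  have e : (Complex.log z * (1 / 2)).im = z.arg / 2 := by
    rw [show (1 / 2 : ℂ) = ((1 / 2 : ℝ) : ℂ) by push_cast; ring, Complex.im_mul_ofReal,
      Complex.log_im]
    ring
  rw [e]
  refine mul_pos (Real.exp_pos _) (Real.cos_pos_of_mem_Ioo ⟨?_, ?_⟩)
  · linarith [Complex.neg_pi_lt_arg z]
  · linarith [lt_of_le_of_ne (Complex.arg_le_pi z) (Complex.slitPlane_arg_ne_pi hz)]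

theorem cpow_half_sq (z : ℂ) : (z ^ (1 / 2 : ℂ)) ^ 2 = z := by
  simp

theorem sq_cpow_half {z : ℂ} (hz : 0 < z.re) : (z ^ 2) ^ (1 / 2 : ℂ) = z := by
  simpa using Complex.sq_cpow_two_inv hz

theorem differentiableAt_cpow_half {f : ℂ → ℂ} {z : ℂ} (hf : DifferentiableAt ℂ f z)
    (hz : f z ∈ Complex.slitPlane) : DifferentiableAt ℂ (fun w => f w ^ (1 / 2 : ℂ)) z :=
  hf.cpow (differentiableAt_const _) hz

theorem mem_slitPlane_of_re_pos {z : ℂ} (hz : 0 < z.re) : z ∈ Complex.slitPlane := Or.inl hz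

/-- If `q q' = 1` and `Re (q + q') > 0`, then `Re q > 0`. -/
theorem re_pos_of_mul_eq_one {q q' : ℂ} (h : q * q' = 1) (hs : 0 < (q + q').re) : 0 < q.re := by
  have h0 : q ≠ 0 := left_ne_zero_of_mul_eq_one h
  have hn := Complex.normSq_pos.2 h0
  rw [eq_inv_of_mul_eq_one_right h, Complex.add_re, Complex.inv_re] at hs
  by_contra! hq
  have := div_nonpos_of_nonpos_of_nonneg hq hn.le
  linarith

theorem re_im_bounds_of_norm_sub_le {w : ℂ} {c a : ℝ} (h : ‖w - (c : ℂ)‖ ≤ a) :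
    (w.re - c) ^ 2 + w.im ^ 2 ≤ a ^ 2 ∧ c - a ≤ w.re ∧ w.re ≤ c + a := by
  have h2 : ‖w - (c : ℂ)‖ ^ 2 = (w.re - c) ^ 2 + w.im ^ 2 := by
    rw [← Complex.normSq_eq_norm_sq, Complex.normSq_apply]
    simp
    ring
  have h3 := (Complex.abs_re_le_norm (w - (c : ℂ))).trans h
  simp only [Complex.sub_re, Complex.ofReal_re] at h3
  rw [abs_le] at h3
  refine ⟨?_, by linarith, by linarith⟩
  rw [← h2]
  exact pow_le_pow_left₀ (norm_nonneg _) h 2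

theorem norm_sq_eq_re_sq_add_im_sq (z : ℂ) : ‖z‖ ^ 2 = z.re ^ 2 + z.im ^ 2 := by
  rw [← Complex.normSq_eq_norm_sq, Complex.normSq_apply]; ring

theorem norm_lt_one_iff_sq {z : ℂ} : ‖z‖ < 1 ↔ z.re ^ 2 + z.im ^ 2 < 1 := by
  rw [← norm_sq_eq_re_sq_add_im_sq, sq_lt_one_iff₀ (norm_nonneg z)]

/-- The disk centred at `c ≥ 1` sits in a disk centred at `1` with the same rightmost point. This is
how conditions on `c + a` are used. -/
theorem norm_sub_one_le_of_norm_sub_le {w : ℂ} {c a : ℝ} (hc : 1 ≤ c) (h : ‖w - (c : ℂ)‖ ≤ a) :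
    ‖w - 1‖ ≤ c + a - 1 := by
  have : ‖((c - 1 : ℝ) : ℂ)‖ = c - 1 := by
    rw [Complex.norm_real, Real.norm_of_nonneg (by linarith)]
  calc ‖w - 1‖ = ‖(w - c) + ((c - 1 : ℝ) : ℂ)‖ := by push_cast; ring_nf
    _ ≤ ‖w - c‖ + ‖((c - 1 : ℝ) : ℂ)‖ := norm_add_le _ _
    _ ≤ c + a - 1 := by linarith

theorem diskCenter_le_of_le {s q C : ℝ} (h0 : 0 ≤ s) (h1 : s ≤ q) (hq : q < 1)
    (hC : diskCenter q ≤ C) : diskCenter s ≤ C := by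
  refine le_trans ?_ hC
  have h4 : s ^ 4 ≤ q ^ 4 := pow_le_pow_left₀ h0 h1 4
  rw [diskCenter, diskCenter, div_le_div_iff₀ (one_sub_pow_four_pos h0 (h1.trans_lt hq))
    (one_sub_pow_four_pos (h0.trans h1) hq)]
  nlinarith

theorem one_add_div_one_sub_lt {s t : ℝ} (h : s < t) (ht : t < 1) :
    (1 + s) / (1 - s) < (1 + t) / (1 - t) := by
  rw [div_lt_div_iff₀ (by linarith) (by linarith)]
  nlinarith

/-- This polynomial is `(1 - s⁴) (c - a - m)`. On `[0, 1]` the growth of its quartic term, whose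
coefficient is below `2`, is outweighed by that of the cubic being subtracted. -/
theorem leftPoly_strictAnti {m x y : ℝ} (hm1 : m < 1) (hx : 0 ≤ x) (hxy : x < y)
    (hy : y ≤ 1) : (1 + m) * y ^ 4 - 2 * y * (y ^ 2 + y + 1) + (1 - m) <
      (1 + m) * x ^ 4 - 2 * x * (x ^ 2 + x + 1) + (1 - m) := by
  have h4 : 0 < y ^ 4 - x ^ 4 := sub_pos.2 (pow_lt_pow_left₀ hxy hx (by norm_num))
  have e1 : y ^ 4 - x ^ 4 ≤ (y - x) * (y ^ 2 + y * x + x ^ 2 + y) := by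
    have : y ^ 4 - x ^ 4 = (y - x) * (y ^ 3 + y ^ 2 * x + y * x ^ 2 + x ^ 3) := by ring
    rw [this]
    refine mul_le_mul_of_nonneg_left ?_ (by linarith)
    have hy0 : 0 ≤ y := by linarith
    nlinarith [mul_nonneg (mul_nonneg hy0 hy0) (sub_nonneg.2 hy),
      mul_nonneg (mul_nonneg hy0 hx) (sub_nonneg.2 hy),
      mul_nonneg (mul_nonneg hx hx) (sub_nonneg.2 hy),
      mul_nonneg (mul_nonneg hx hx) (sub_nonneg.2 (hxy.le.trans hy)), mul_nonneg hy0 hx]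
  have e2 : (1 + m) * (y ^ 4 - x ^ 4) < 2 * (y ^ 4 - x ^ 4) := by nlinarith
  nlinarith [mul_nonneg (sub_nonneg.2 hxy.le) hx]

/-- The smallest positive root of the equation saying that the leftmost point of the disk is `m`. -/
theorem exists_leftRadius {m lo hi : ℝ} {eq : ℝ → Prop} (hm1 : m < 1) (hlo : 0 ≤ lo)
    (hhi : hi ≤ 1) (hlt : lo < hi) (h1 : 0 < (1 + m) * lo ^ 4 - 2 * lo * (lo ^ 2 + lo + 1) + (1 - m))
    (h2 : (1 + m) * hi ^ 4 - 2 * hi * (hi ^ 2 + hi + 1) + (1 - m) < 0)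
    (heq : ∀ r, eq r ↔ (1 + m) * r ^ 4 - 2 * r * (r ^ 2 + r + 1) + (1 - m) = 0) :
    ∃ R, lo < R ∧ R < hi ∧ IsLeastPosRoot eq R ∧
      (∀ s, 0 ≤ s → s < R → m < diskCenter s - diskRadius s) ∧
      ∀ s, R < s → s < 1 → diskCenter s - diskRadius s < m := by
  have hc : ContinuousOn (fun r : ℝ => (1 + m) * r ^ 4 - 2 * r * (r ^ 2 + r + 1) + (1 - m))
      (Set.Icc lo hi) := by fun_prop
  obtain ⟨R, ⟨hR1, hR2⟩, hR⟩ := intermediate_value_Ioo' hlt.le hc ⟨h2, h1⟩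
  beta_reduce at hR
  have hpos : ∀ s, 0 ≤ s → s < R → 0 < (1 + m) * s ^ 4 - 2 * s * (s ^ 2 + s + 1) + (1 - m) :=
    fun s hs0 hs => hR ▸ leftPoly_strictAnti hm1 hs0 hs (by linarith)
  refine ⟨R, hR1, hR2, ⟨⟨by linarith, (heq R).2 hR⟩, fun s ⟨hs0, hs⟩ => ?_⟩, fun s hs0 hs => ?_,
    fun s hs hs1 => ?_⟩
  · by_contra! hsR
    exact (hpos s hs0.le hsR).ne' ((heq s).1 hs)
  · rw [diskCenter_sub_diskRadius, lt_div_iff₀ (one_sub_pow_four_pos hs0 (by linarith))]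
    linarith [hpos s hs0 hs]
  · have := leftPoly_strictAnti hm1 (by linarith) hs hs1.le
    rw [diskCenter_sub_diskRadius,
      div_lt_iff₀ (one_sub_pow_four_pos (by linarith) hs1)]
    linarith

theorem isExtremalAt_extremalF3 {h : ℂ → ℂ} {m R : ℝ} (h0 : 0 ≤ R)
    (hR : ∀ s, R < s → s < 1 → diskCenter s - diskRadius s < m)
    (hv : ∀ v : ℝ, v < m → ∀ t ∈ diskD, h t ≠ v) :
    IsExtremalAt (starClass h) classK3 R extremalF3 :=
  isExtremalAt_of_starQuot h0 extremalF3_mem_and_starQuot.1 extremalF3_mem_and_starQuot.2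
    fun s hs hs1 _ hf _ hz => starQuot_ne_of_mem_starClass (hv _ (hR s hs hs1)) hf hz

theorem isExtremalAt_extremalKoebe {h : ℂ → ℂ} {R : ℝ} (h0 : 0 ≤ R)
    (hv : ∀ v : ℝ, (1 + R) / (1 - R) < v → ∀ t ∈ diskD, h t ≠ v) :
    IsExtremalAt (starClass h) classK3 R extremalKoebe :=
  isExtremalAt_of_starQuot h0 extremalKoebe_mem_and_starQuot.1 extremalKoebe_mem_and_starQuot.2
    fun _ hs hs1 _ hf _ hz =>
      starQuot_ne_of_mem_starClass (hv _ (one_add_div_one_sub_lt hs hs1)) hf hz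

/-! ### Half-plane -/

theorem radius_classSOrder {α : ℝ} (h1 : α < 1) : ∃ R : ℝ,
    IsLeastPosRoot (fun r => (1 + α) * r ^ 4 - 2 * r * (r ^ 2 + r + 1) + (1 - α) = 0) R ∧
    IsClassRadius (classSOrder α) classK3 R ∧
    IsExtremalAt (classSOrder α) classK3 R extremalF3 := by
  obtain ⟨R, hR0, hR1, hroot, hin, hout⟩ := exists_leftRadius (m := α) (lo := 0) (hi := 1) h1 le_rfl
    le_rfl one_pos (by linarith) (by linarith) (fun r => Iff.rfl)
  refine ⟨R, hroot, isClassRadius_of_isExtremalAt hR0.le hR1.le ?_ ?_⟩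
  · refine dilatesInto_starClass (g := fun w => (w - 1) / (w + 1 - 2 * α)) hR1.le ?_ (by simp) ?_
    · exact DifferentiableOn.div (by fun_prop) (by fun_prop) fun z hz => one_sub_ne_zero hz
    · intro s hs0 hsR w hw
      have hre : α < w.re := (hin s hs0 hsR).trans_le (re_im_bounds_of_norm_sub_le hw).2.1
      have hne : w + 1 - 2 * α ≠ 0 := by
        intro h
        have := congrArg Complex.re h
        simp at this
        linarith
      have hα : (1 : ℂ) - α ≠ 0 := by
        have : 1 - α ≠ 0 := by linarith
        exact_mod_cast this
      refine ⟨DifferentiableAt.div (by fun_prop) (by fun_prop) hne, ?_, ?_⟩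
      · rw [norm_div, div_lt_one (norm_pos_iff.2 hne)]
        refine lt_of_pow_lt_pow_left₀ 2 (norm_nonneg _) ?_
        rw [norm_sq_eq_re_sq_add_im_sq, norm_sq_eq_re_sq_add_im_sq]
        simp
        nlinarith
      · have e1 : 1 - (w - 1) / (w + 1 - 2 * α) = 2 * (1 - α) / (w + 1 - 2 * α) := by
          field_simp
          ring
        simp only [e1]
        field_simp
        ring
  · refine isExtremalAt_extremalF3 hR0.le hout fun v hv t ht h => ?_
    have h2 := one_sub_ne_zero ht
    rw [div_eq_iff h2] at h
    have hr := congrArg Complex.re h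
    simp at hr
    have ht1 := re_sq_add_im_sq_lt_one ht
    -- The real part of `h` rearranges to `(1 - x) (v - α) = (1 - α) (1 + x)` with `x = Re t`, which
    -- is impossible for `v < α`.
    have hx : -1 < t.re ∧ t.re < 1 := abs_lt.1 (by rw [← sq_lt_one_iff_abs_lt_one]; nlinarith)
    nlinarith [mul_pos (show 0 < 1 + t.re by linarith) (sub_pos.2 h1),
      mul_pos (sub_pos.2 hx.2) (sub_pos.2 hv)]

/-! ### Lemniscate -/

theorem norm_sq_sub_one (w : ℂ) : ‖w ^ 2 - 1‖ = ‖w - 1‖ * ‖w + 1‖ := by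
  rw [← norm_mul]
  ring_nf

/-- With `A = c + a`, `|w² - 1| = |w - 1| |w + 1| ≤ (A - 1)(A + 1)`, which is below `1` as soon as
`A < √2`; and `(1 + R) / (1 - R) = √2`. -/
theorem radius_classSL : ∃ R : ℝ, R = (√2 - 1) / (√2 + 1) ∧ |R - 0.171573| < 5e-7 ∧
    IsClassRadius classSL classK3 R ∧ IsExtremalAt classSL classK3 R extremalKoebe := by
  have h2 : √2 ^ 2 = 2 := Real.sq_sqrt (by norm_num)
  have hlo : 1.41421356 < √2 := Real.lt_sqrt_of_sq_lt (by norm_num)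
  have hhi : √2 < 1.41421357 := (Real.sqrt_lt' (by norm_num)).2 (by norm_num)
  set R : ℝ := (√2 - 1) / (√2 + 1) with hR
  have hR' : R = 3 - 2 * √2 := by
    rw [hR, div_eq_iff (by linarith)]
    nlinarith
  have hR0 : 0 < R := by rw [hR']; linarith
  have hR1 : R < 1 := by rw [hR']; linarith
  have hval : (1 + R) / (1 - R) = √2 := by
    rw [div_eq_iff (by linarith), hR']
    nlinarith
  refine ⟨R, rfl, ?_, isClassRadius_of_isExtremalAt hR0.le hR1.le ?_ ?_⟩
  · rw [hR', abs_lt]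
    constructor <;> linarith
  · refine dilatesInto_starClass (g := fun w => w ^ 2 - 1) hR1.le ?_ (by simp) ?_
    · intro z hz
      refine (differentiableAt_cpow_half (by fun_prop) ?_).differentiableWithinAt
      apply mem_slitPlane_of_re_pos
      have := re_sq_add_im_sq_lt_one hz
      simp
      nlinarith
    · intro s hs0 hsR w hw
      have hs1 := hsR.trans hR1
      have hsum : diskCenter s + diskRadius s < √2 := by
        rw [diskCenter_add_diskRadius hs0 hs1, ← hval]
        exact one_add_div_one_sub_lt hsR hR1
      have hc := one_le_diskCenter hs0 hs1
      have hn := norm_sub_one_le_of_norm_sub_le hc hw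
      refine ⟨by fun_prop, ?_, ?_⟩
      · have hn' : ‖w + 1‖ ≤ diskCenter s + diskRadius s + 1 := by
          calc ‖w + 1‖ = ‖(w - 1) + 2‖ := by ring_nf
            _ ≤ ‖w - 1‖ + ‖(2 : ℂ)‖ := norm_add_le _ _
            _ ≤ _ := by simp; linarith
        rw [norm_sq_sub_one]
        have ha := diskRadius_nonneg hs0 hs1
        nlinarith [mul_le_mul hn hn' (norm_nonneg _) (by linarith)]
      · rw [add_sub_cancel]
        apply sq_cpow_half
        linarith [(re_im_bounds_of_norm_sub_le hw).2.1]
  · refine isExtremalAt_extremalKoebe hR0.le fun v hv t ht h => ?_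
    rw [hval] at hv
    have h3 := cpow_half_sq (1 + t)
    rw [h] at h3
    have h4 : t = ((v ^ 2 - 1 : ℝ) : ℂ) := by
      push_cast
      rw [h3]
      ring
    rw [mem_diskD, h4, Complex.norm_real, Real.norm_eq_abs, abs_lt] at ht
    nlinarith

/-! ### Parabola -/

theorem radius_classSP : ∃ R : ℝ,
    IsLeastPosRoot (fun r => 4 * r ^ 3 + 4 * r ^ 2 + 4 * r - 1 - 3 * r ^ 4 = 0) R ∧
    |R - 0.2021347| < 5e-8 ∧ IsClassRadius classSP classK3 R ∧
    IsExtremalAt classSP classK3 R extremalF3 := by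
  -- The sign change is tested within the rounding interval of the stated decimal, so the bracket
  -- also certifies the approximation. The same is done for the other polynomial equations with a
  -- decimal value.
  obtain ⟨R, hR0, hR1, hroot, hin, hout⟩ := exists_leftRadius (m := 1 / 2)
    (lo := 0.20213466) (hi := 0.20213474)
    (eq := fun r => 4 * r ^ 3 + 4 * r ^ 2 + 4 * r - 1 - 3 * r ^ 4 = 0)
    (by norm_num) (by norm_num) (by norm_num) (by norm_num) (by norm_num) (by norm_num)
    (fun r => by constructor <;> intro h <;> linarith)
  refine ⟨R, hroot, by rw [abs_lt]; constructor <;> linarith,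
    isClassRadius_of_isExtremalAt (by linarith) (by linarith) ?_ ?_⟩
  · intro f hf r hr0 hrR
    refine ⟨dilate_mem_classA hr0 (by linarith) hf.1,
      fun z hz hz0 => dilate_ne_zero hr0 (by linarith) hf hz hz0, fun z hz => ?_⟩
    obtain ⟨s, hs0, hs, hw⟩ := exists_norm_starQuot_dilate_sub_le hr0 (by linarith) hf hz
    obtain ⟨h1, h2, -⟩ := re_im_bounds_of_norm_sub_le hw
    have h3 := hin s hs0 (by linarith)
    have h4 := one_le_diskCenter hs0 (by linarith)
    have h5 := diskRadius_nonneg hs0 (by linarith)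
    -- From `a < c - 1/2` one gets `y² < (x - 1/2)(2c - 1/2 - x)`, which is at most `2x - 1` when `x
    -- > 1/2` and `c ≤ 3/2`. The bound `1.01` is ample.
    have h6 := diskCenter_le_of_le (C := 1.01) hs0 (by linarith : s ≤ 0.25) (by norm_num)
      (by norm_num [diskCenter])
    nlinarith
  · refine isExtremalAt_of_starQuot (by linarith) extremalF3_mem_and_starQuot.1
      extremalF3_mem_and_starQuot.2 fun s hs hs1 f hf z hz h => ?_
    have h1 := hf.2.2 z hz
    have h2 := hout s hs hs1
    rw [h] at h1
    simp only [Complex.ofReal_im, Complex.ofReal_re] at h1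
    linarith

/-! ### Cardioid -/

theorem radius_classSC : ∃ R : ℝ,
    IsLeastPosRoot (fun r => 3 * r ^ 3 + 3 * r ^ 2 + 3 * r - 1 - 2 * r ^ 4 = 0) R ∧
    |R - 0.254726| < 5e-7 ∧ IsClassRadius classSC classK3 R ∧
    IsExtremalAt classSC classK3 R extremalF3 := by
  obtain ⟨R, hR0, hR1, hroot, hin, hout⟩ := exists_leftRadius (m := 1 / 3)
    (lo := 0.254726) (hi := 0.2547264999)
    (eq := fun r => 3 * r ^ 3 + 3 * r ^ 2 + 3 * r - 1 - 2 * r ^ 4 = 0)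
    (by norm_num) (by norm_num) (by norm_num) (by norm_num) (by norm_num) (by norm_num)
    (fun r => by constructor <;> intro h <;> linarith)
  refine ⟨R, hroot, by rw [abs_lt]; constructor <;> linarith,
    isClassRadius_of_isExtremalAt (by linarith) (by linarith) ?_ ?_⟩
  -- Completing the square, `h(z) = (2 (1 + z)² + 1) / 3`.
  · refine dilatesInto_starClass (g := fun w => ((3 * w - 1) / 2) ^ (1 / 2 : ℂ) - 1) (by linarith)
      (by fun_prop) (by norm_num) ?_
    intro s hs0 hsR w hw
    obtain ⟨h1, h2, -⟩ := re_im_bounds_of_norm_sub_le hw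
    have h3 := hin s hs0 (by linarith)
    have h4 := one_le_diskCenter hs0 (by linarith)
    have h5 := diskRadius_nonneg hs0 (by linarith)
    have h6 := diskCenter_le_of_le (C := 1.01) hs0 (by linarith : s ≤ 0.26) (by norm_num)
      (by norm_num [diskCenter])
    have hsl : (3 * w - 1) / 2 ∈ Complex.slitPlane := by
      apply mem_slitPlane_of_re_pos
      rw [show (3 * w - 1) / 2 = ((1 / 2 : ℝ) : ℂ) * (3 * w - 1) by push_cast; ring,
        Complex.re_ofReal_mul]
      simp
      linarith
    have hq := re_cpow_half_pos hsl
    have hq2 := cpow_half_sq ((3 * w - 1) / 2)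
    refine ⟨(differentiableAt_cpow_half (f := fun w => (3 * w - 1) / 2) (by fun_prop) hsl).sub_const 1, ?_, ?_⟩
    · set q := ((3 * w - 1) / 2) ^ (1 / 2 : ℂ) with hqdef
      have hwq : w = (2 * q ^ 2 + 1) / 3 := by rw [hq2]; ring
      have hre : w.re = (2 * (q.re ^ 2 - q.im ^ 2) + 1) / 3 := by
        rw [hwq, show (2 * q ^ 2 + 1) / 3 = ((1 / 3 : ℝ) : ℂ) * (2 * (q * q) + 1) by
          push_cast; ring, Complex.re_ofReal_mul]
        simp
        ring
      have him : w.im = 4 * (q.re * q.im) / 3 := by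
        rw [hwq, show (2 * q ^ 2 + 1) / 3 = ((1 / 3 : ℝ) : ℂ) * (2 * (q * q) + 1) by
          push_cast; ring, Complex.im_ofReal_mul]
        simp
        ring
      rw [norm_lt_one_iff_sq]
      simp only [Complex.sub_re, Complex.one_re, Complex.sub_im, Complex.one_im, sub_zero]
      set x := q.re
      set y := q.im
      set n := x ^ 2 + y ^ 2 with hn
      set C := (3 * diskCenter s - 1) / 2 with hC
      have hn0 : 0 < n := by positivity
      have hCa : 3 * diskRadius s / 2 < C := by rw [hC]; linarith
      -- This is `|q² - C| < C`, from `q² = (3w - 1) / 2` and `c - a > 1/3`. The goal `|q - 1| < 1`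
      -- reads `n < 2x`, where `n = |q|²`.
      have k1 : n ^ 2 < 2 * C * (2 * x ^ 2 - n) := by
        have e : n ^ 2 - 2 * C * (2 * x ^ 2 - n) + C ^ 2 =
            9 / 4 * ((w.re - diskCenter s) ^ 2 + w.im ^ 2) := by
          rw [hre, him, hn, hC]
          ring
        have : (3 * diskRadius s / 2) ^ 2 < C ^ 2 := pow_lt_pow_left₀ hCa (by positivity) two_ne_zero
        nlinarith
      have hC1 : 1 ≤ C := by rw [hC]; linarith
      have hC2 : C ≤ 1.02 := by rw [hC]; linarith
      have k2 : n < 2 * C := by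
        have : 2 * C * (2 * x ^ 2 - n) ≤ 2 * C * n := by
          have : 2 * x ^ 2 - n ≤ n := by rw [hn]; nlinarith
          nlinarith
        nlinarith
      -- From `k1`, `n² + 2Cn < 4Cx²`. The left side is at least `C n²` because `n (C - 1) ≤ 2C`:
      -- here `n < 2C` and `C` is near `1`.
      have k3 : C * n ^ 2 < C * (4 * x ^ 2) := by
        have : n * (n * (C - 1)) ≤ n * (2 * C) :=
          mul_le_mul_of_nonneg_left (by nlinarith) hn0.le
        nlinarith
      have k4 : n < 2 * x := by
        have := lt_of_mul_lt_mul_left k3 (by linarith)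
        nlinarith
      nlinarith
    · linear_combination (2 / 3) * hq2
  · refine isExtremalAt_extremalF3 (by linarith) hout fun v hv t ht h => ?_
    have h1 : (1 + t) ^ 2 = (((3 * v - 1) / 2 : ℝ) : ℂ) := by
      push_cast
      linear_combination (3 / 2) * h
    have hr := congrArg Complex.re h1
    have hi := congrArg Complex.im h1
    rw [pow_two] at hr hi
    simp only [Complex.mul_re, Complex.mul_im, Complex.add_re, Complex.add_im, Complex.one_re,
      Complex.one_im, Complex.ofReal_re, Complex.ofReal_im, zero_add] at hr hi
    have ht1 := re_sq_add_im_sq_lt_one ht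
    have hx : 0 < 1 + t.re := by nlinarith
    have hy : t.im = 0 := by
      have : (1 + t.re) * t.im = 0 := by linarith
      exact (mul_eq_zero.1 this).resolve_left hx.ne'
    rw [hy] at hr
    nlinarith

/-! ### Lune -/

theorem one_add_sq_mem_slitPlane {z : ℂ} (hz : z ∈ diskD) : 1 + z ^ 2 ∈ Complex.slitPlane := by
  apply mem_slitPlane_of_re_pos
  have := re_sq_add_im_sq_lt_one hz
  rw [pow_two]
  simp
  nlinarith

theorem radius_classSMoon : ∃ R : ℝ,
    IsLeastPosRoot (fun r => 2 * r ^ 3 + 2 * r ^ 2 + 2 * r - √2 * r ^ 4 = 2 - √2) R ∧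
    |R - 0.229877| < 5e-7 ∧ IsClassRadius classSMoon classK3 R ∧
    IsExtremalAt classSMoon classK3 R extremalF3 := by
  have h2 : √2 ^ 2 = 2 := Real.sq_sqrt (by norm_num)
  have hlo : 1.41421356 < √2 := Real.lt_sqrt_of_sq_lt (by norm_num)
  have hhi : √2 < 1.41421357 := (Real.sqrt_lt' (by norm_num)).2 (by norm_num)
  obtain ⟨R, hR0, hR1, hroot, hin, hout⟩ := exists_leftRadius (m := √2 - 1)
    (lo := 0.2298766) (hi := 0.2298772)
    (eq := fun r => 2 * r ^ 3 + 2 * r ^ 2 + 2 * r - √2 * r ^ 4 = 2 - √2)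
    (by linarith) (by norm_num) (by norm_num) (by norm_num) (by norm_num; linarith)
    (by norm_num; linarith)
    (fun r => by constructor <;> intro h <;> linarith)
  refine ⟨R, hroot, by rw [abs_lt]; constructor <;> linarith,
    isClassRadius_of_isExtremalAt (by linarith) (by linarith) ?_ ?_⟩
  · refine dilatesInto_starClass (g := fun w => (w - w⁻¹) / 2) (by linarith) ?_ (by simp) ?_
    · exact fun z hz => (differentiableAt_fun_id.fun_add (differentiableAt_cpow_half
        (f := fun z => 1 + z ^ 2) (by fun_prop)
        (one_add_sq_mem_slitPlane hz))).differentiableWithinAt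
    intro s hs0 hsR w hw
    obtain ⟨h1, h4, -⟩ := re_im_bounds_of_norm_sub_le hw
    have h3 := hin s hs0 (by linarith)
    have hc := one_le_diskCenter hs0 (by linarith)
    have ha := diskRadius_nonneg hs0 (by linarith)
    have hsum : diskCenter s + diskRadius s < 1.7 := by
      rw [diskCenter_add_diskRadius hs0 (by linarith)]
      refine (one_add_div_one_sub_lt (t := 0.24) (by linarith) (by norm_num)).trans (by norm_num)
    have hn := norm_sub_one_le_of_norm_sub_le hc hw
    have hre : 0 < w.re := by linarith
    have hw0 : w ≠ 0 := by rintro rfl; simp at hre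
    refine ⟨by fun_prop (disch := assumption), ?_, ?_⟩
    -- The lune condition `|w² - 1| < 2 |w|` follows from `|w - 1| < √2 < |w + 1|`, since `(2 - |w -
    -- 1|²)(|w + 1|² - 2) = 4 |w|² - |w² - 1|²`.
    · have hn2 : √2 < ‖w + 1‖ := by
        refine lt_of_lt_of_le ?_ (Complex.re_le_norm _)
        simp
        linarith
      have e : (w - w⁻¹) / 2 = (w ^ 2 - 1) / (2 * w) := by field_simp
      have hd : 0 < ‖2 * w‖ := norm_pos_iff.2 (mul_ne_zero two_ne_zero hw0)
      have hn1 : ‖w - 1‖ < √2 := by linarith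
      have a1 := norm_sq_eq_re_sq_add_im_sq (w - 1)
      have a2 := norm_sq_eq_re_sq_add_im_sq (w + 1)
      have a3 := norm_sq_eq_re_sq_add_im_sq w
      simp only [Complex.sub_re, Complex.one_re, Complex.sub_im, Complex.one_im, sub_zero,
        Complex.add_re, Complex.add_im, add_zero] at a1 a2
      have b1 : ‖w - 1‖ ^ 2 < 2 := by
        rw [← h2]; exact pow_lt_pow_left₀ hn1 (norm_nonneg _) two_ne_zero
      have b2 : 2 < ‖w + 1‖ ^ 2 := by rw [← h2]; exact pow_lt_pow_left₀ hn2 (by positivity) two_ne_zero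
      rw [e, norm_div, div_lt_one hd, norm_sq_sub_one, norm_mul, Complex.norm_ofNat]
      refine lt_of_pow_lt_pow_left₀ 2 (by positivity) ?_
      rw [mul_pow, mul_pow]
      linarith [mul_pos (sub_pos.2 b1) (sub_pos.2 b2)]
    · have e : 1 + ((w - w⁻¹) / 2) ^ 2 = ((w + w⁻¹) / 2) ^ 2 := by
        field_simp
        ring
      have hpos : 0 < ((w + w⁻¹) / 2).re := by
        rw [show (w + w⁻¹) / 2 = ((1 / 2 : ℝ) : ℂ) * (w + w⁻¹) by push_cast; ring,
          Complex.re_ofReal_mul, Complex.add_re, Complex.inv_re]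
        have := Complex.normSq_pos.2 hw0
        positivity
      rw [e, sq_cpow_half hpos]
      ring
  · refine isExtremalAt_extremalF3 (by linarith) hout fun v hv t ht h => ?_
    have hs := re_cpow_half_pos (one_add_sq_mem_slitPlane ht)
    have hs2 := cpow_half_sq (1 + t ^ 2)
    set S := (1 + t ^ 2) ^ (1 / 2 : ℂ) with hS
    -- The reciprocal of `t + S` is `S - t`, and their sum `2S` has positive real part; hence so has
    -- `t + S`, which forces `v > 0`.
    have hprod : (t + S) * (S - t) = 1 := by linear_combination hs2
    have hq := re_pos_of_mul_eq_one hprod (by simp; linarith)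
    rw [h] at hq hprod
    simp only [Complex.ofReal_re] at hq
    have hv0 : (v : ℂ) ≠ 0 := by exact_mod_cast hq.ne'
    have ht2 : t = (((v ^ 2 - 1) / (2 * v) : ℝ) : ℂ) := by
      push_cast
      field_simp
      linear_combination 2 * (v : ℂ) * h - hprod - (v : ℂ) * h
    rw [mem_diskD, ht2, Complex.norm_real, Real.norm_eq_abs, abs_lt, lt_div_iff₀ (by linarith)] at ht
    nlinarith [ht.1]

/-! ### Exponential -/

theorem exp_neg_one_bounds : 0.36787944 < Real.exp (-1) ∧ Real.exp (-1) < 0.3678794413 := by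
  have h1 := Real.exp_one_gt_d9
  have h2 := Real.exp_one_lt_d9
  have h3 : Real.exp 1 * Real.exp (-1) = 1 := by rw [← Real.exp_add]; simp
  have h4 := Real.exp_pos (-1)
  constructor <;> nlinarith

theorem cos_le_of_le_sq {y s : ℝ} (hs0 : 0 ≤ s) (hs1 : s ≤ 1) (hy : |y| ≤ Real.pi)
    (h : s ≤ y ^ 2) : Real.cos y ≤ 1 - s / 2 + 5 / 96 * s ^ 2 := by
  have h1 : √s ≤ |y| := Real.sqrt_le_iff.2 ⟨abs_nonneg _, by rwa [sq_abs]⟩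
  have h2 : Real.cos |y| ≤ Real.cos √s :=
    Real.cos_le_cos_of_nonneg_of_le_pi (Real.sqrt_nonneg _) hy h1
  have h3 : |√s| ≤ 1 := by
    rw [abs_of_nonneg (Real.sqrt_nonneg _)]
    exact Real.sqrt_le_one.2 hs1
  have h4 := (abs_le.1 (Real.cos_bound h3)).2
  rw [abs_of_nonneg (Real.sqrt_nonneg _), Real.sq_sqrt hs0,
    show √s ^ 4 = (√s ^ 2) ^ 2 by ring, Real.sq_sqrt hs0] at h4
  rw [Real.cos_abs] at h2
  linarith

/-- The polynomial is the bound of `cos_le_of_le_sq` at `s = 1 - x²`, with `u = 1 + x`. The slope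
`0.3` is small enough that `1.01 · 0.3 < 1 / e`, as needed in `exp_dist_center_ge`. -/
theorem quartic_sub_exp_neg_le {u : ℝ} (hu0 : 0 < u) (hu1 : u < 1) :
    1 - u + u ^ 2 / 2 + 5 / 96 * (u ^ 2 * (2 - u) ^ 2) - Real.exp (-u) ≤ 0.3 * u := by
  have h1 : 1 - u + u ^ 2 / 2 - u ^ 3 / 6 - 5 / 96 * u ^ 4 ≤ Real.exp (-u) := by
    have := (abs_le.1 (Real.exp_bound (x := -u) (by rw [abs_neg, abs_of_pos hu0]; linarith)
      (n := 4) (by norm_num))).1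
    rw [abs_neg, abs_of_pos hu0] at this
    simp [Finset.sum_range_succ, Nat.factorial] at this
    linarith
  have hB : u ^ 2 / 6 + 5 / 96 * (u ^ 3 + u * (2 - u) ^ 2) ≤ 0.3 := by
    have b1 : u ^ 2 ≤ 1 := pow_le_one₀ hu0.le hu1.le
    have b2 : u ^ 3 ≤ 1 := pow_le_one₀ hu0.le hu1.le
    have b3 : (u - 2 / 3) ^ 2 * (u - 8 / 3) ≤ 0 :=
      mul_nonpos_of_nonneg_of_nonpos (sq_nonneg _) (by linarith)
    linarith
  linarith [mul_le_mul_of_nonneg_left hB hu0.le]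

/-- Outside the image of the unit disk under `exp`, the distance to a centre `c` close to `1` is at
least `c - 1 / e`. -/
theorem exp_dist_center_ge {c x y : ℝ} (hc1 : 1 ≤ c) (hc2 : c ≤ 1.01) (hy : |y| ≤ Real.pi)
    (h : 1 ≤ x ^ 2 + y ^ 2) :
    2 * c * (Real.exp x * Real.cos y - Real.exp (-1)) ≤ Real.exp x ^ 2 - Real.exp (-1) ^ 2 := by
  obtain ⟨he1, he2⟩ := exp_neg_one_bounds
  set ε := Real.exp (-1) with hε
  set E := Real.exp x with hE
  have hE0 : 0 < E := Real.exp_pos x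
  have hcE : 0 < 2 * c * E := by positivity
  -- The inequality says `|w - c|² ≥ (c - ε)²` for `w = e^(x + iy)`. Bounding the cosine by `1`
  -- already suffices if `E ≤ ε` or `E + ε ≥ 2c`.
  have far : 0 ≤ (E - ε) * (E + ε - 2 * c) →
      2 * c * (E * Real.cos y - ε) ≤ E ^ 2 - ε ^ 2 := by
    intro h0
    nlinarith [mul_le_mul_of_nonneg_left (Real.cos_le_one y) hcE.le]
  rcases le_or_gt x (-1) with hx | hx
  · have : E ≤ ε := Real.exp_le_exp.2 hx
    exact far (by nlinarith)
  rcases le_or_gt 0.55 x with hx2 | hx2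
  · have : 1.7 ≤ E := by
      have := Real.quadratic_le_exp_of_nonneg (by linarith : 0 ≤ x)
      nlinarith
    exact far (mul_nonneg (by linarith) (by linarith))
  have hK := cos_le_of_le_sq (y := y) (s := 1 - x ^ 2) (by nlinarith) (by nlinarith) hy
    (by linarith)
  set K := 1 - (1 - x ^ 2) / 2 + 5 / 96 * (1 - x ^ 2) ^ 2 with hKdef
  suffices hs : 2 * c * (E * K - ε) ≤ E ^ 2 - ε ^ 2 by
    nlinarith [mul_le_mul_of_nonneg_left hK hcE.le]
  rcases le_or_gt 0 x with hx0 | hx0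
  · have hx3 : x ^ 2 ≤ 0.3025 := by nlinarith
    have hK1 : K ≤ 0.7034 := by
      rw [hKdef]
      nlinarith [sq_nonneg x]
    have hK0 : 0 ≤ K := by
      rw [hKdef]
      nlinarith [sq_nonneg x, sq_nonneg (1 - x ^ 2)]
    -- The quadratic `E² - 2cK E + 2cε - ε²` has no real zero, since `(cK)² ≤ 0.5184` while `2cε -
    -- ε²` is about `0.6` or more.
    have h1 : c * K ≤ 0.72 := by nlinarith
    have h2 : (c * K) ^ 2 ≤ 0.5184 := by nlinarith [mul_nonneg (by linarith : 0 ≤ c) hK0]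
    nlinarith [sq_nonneg (E - c * K)]
  -- Here `E = ε eᵘ`. Dividing by `E` leaves `2c (K - e⁻ᵘ) ≤ 2ε sinh u`, where `sinh u ≥ u` and the
  -- left side is at most `0.6 c u`.
  · set u := x + 1 with hu
    have hu0 : 0 < u := by linarith
    have hu1 : u < 1 := by linarith
    set e' := Real.exp (-u) with he'
    have h2 : E * e' = ε := by
      rw [hE, he', hε, ← Real.exp_add]
      congr 1
      rw [hu]
      ring
    have h4 : ε * Real.exp u = E := by
      rw [hE, hε, ← Real.exp_add]
      congr 1
      rw [hu]
      ring
    have h5 : 2 * u ≤ Real.exp u - e' := by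
      have := Real.self_le_sinh_iff.2 hu0.le
      rw [Real.sinh_eq] at this
      linarith
    have hKu : K = 1 - u + u ^ 2 / 2 + 5 / 96 * (u ^ 2 * (2 - u) ^ 2) := by
      rw [hKdef, show x = u - 1 by rw [hu]; ring]
      ring
    have h6 : K - e' ≤ 0.3 * u := by
      rw [hKu]
      exact quartic_sub_exp_neg_le hu0 hu1
    have h7 : 2 * c * (K - e') ≤ ε * (Real.exp u - e') := by
      have q1 : ε * (2 * u) ≤ ε * (Real.exp u - e') :=
        mul_le_mul_of_nonneg_left h5 (by linarith)
      have q2 : 2 * c * (K - e') ≤ 2 * c * (0.3 * u) :=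
        mul_le_mul_of_nonneg_left h6 (by linarith)
      have q3 : c * u ≤ 1.01 * u := mul_le_mul_of_nonneg_right hc2 hu0.le
      have q4 : 0.36787944 * u ≤ ε * u := mul_le_mul_of_nonneg_right he1.le hu0.le
      linarith
    have h8 := mul_le_mul_of_nonneg_left h7 hE0.le
    have h9 : E * (2 * c * (K - e')) = 2 * c * (E * K - ε) := by rw [← h2]; ring
    have h10 : E * (ε * (Real.exp u - e')) = E ^ 2 - ε ^ 2 := by
      linear_combination E * h4 - ε * h2
    linarith

theorem radius_classSE : ∃ R : ℝ,
    IsLeastPosRoot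
      (fun r => (2 * r ^ 3 + 2 * r ^ 2 + 2 * r - 1 - r ^ 4) * Real.exp 1 + 1 - r ^ 4 = 0) R ∧
    |R - 0.244259| < 5e-7 ∧ IsClassRadius classSE classK3 R ∧
    IsExtremalAt classSE classK3 R extremalF3 := by
  obtain ⟨he1, he2⟩ := exp_neg_one_bounds
  have hee : Real.exp 1 * Real.exp (-1) = 1 := by rw [← Real.exp_add]; simp
  obtain ⟨R, hR0, hR1, hroot, hin, hout⟩ := exists_leftRadius (m := Real.exp (-1))
    (lo := 0.244259) (hi := 0.2442594)
    (eq := fun r => (2 * r ^ 3 + 2 * r ^ 2 + 2 * r - 1 - r ^ 4) * Real.exp 1 + 1 - r ^ 4 = 0)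
    (by linarith) (by norm_num) (by norm_num) (by norm_num) (by norm_num; linarith)
    (by norm_num; linarith)
    (fun r => by
      constructor <;> intro h
      · linear_combination -Real.exp (-1) * h +
          (2 * r ^ 3 + 2 * r ^ 2 + 2 * r - 1 - r ^ 4) * hee
      · linear_combination -Real.exp 1 * h + (1 - r ^ 4) * (-hee))
  refine ⟨R, hroot, by rw [abs_lt]; constructor <;> linarith,
    isClassRadius_of_isExtremalAt (by linarith) (by linarith) ?_ ?_⟩
  · refine dilatesInto_starClass (g := Complex.log) (by linarith)
      Complex.differentiable_exp.differentiableOn (by simp) ?_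
    intro s hs0 hsR w hw
    obtain ⟨h1, h4, -⟩ := re_im_bounds_of_norm_sub_le hw
    have h3 := hin s hs0 (by linarith)
    have hc := one_le_diskCenter hs0 (by linarith)
    have ha := diskRadius_nonneg hs0 (by linarith)
    have hc2 := diskCenter_le_of_le (C := 1.01) hs0 (by linarith : s ≤ 0.25) (by norm_num)
      (by norm_num [diskCenter])
    have hre : 0 < w.re := by linarith
    have hw0 : w ≠ 0 := by rintro rfl; simp at hre
    refine ⟨Complex.differentiableAt_log (Or.inl hre), ?_, Complex.exp_log hw0⟩
    -- If `|log w| ≥ 1`, then `exp_dist_center_ge` puts `w` at distance at least `c - 1/e > a` from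
    -- the centre.
    by_contra! hn
    have hn2 : 1 ≤ (Complex.log w).re ^ 2 + (Complex.log w).im ^ 2 := by
      rw [← norm_sq_eq_re_sq_add_im_sq]
      exact one_le_pow₀ hn
    have key := exp_dist_center_ge hc hc2 (Complex.log_im w ▸ Complex.abs_arg_le_pi w) hn2
    have hr : Real.exp (Complex.log w).re * Real.cos (Complex.log w).im = w.re := by
      rw [← Complex.exp_re, Complex.exp_log hw0]
    have hm : Real.exp (Complex.log w).re ^ 2 = w.re ^ 2 + w.im ^ 2 := by
      rw [← Complex.norm_exp, Complex.exp_log hw0, norm_sq_eq_re_sq_add_im_sq]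
    rw [hr, hm] at key
    nlinarith
  · refine isExtremalAt_extremalF3 (by linarith) hout fun v hv t ht h => ?_
    have hr := congrArg Complex.re h
    have hi := congrArg Complex.im h
    rw [Complex.exp_re, Complex.ofReal_re] at hr
    rw [Complex.exp_im, Complex.ofReal_im] at hi
    have ht1 := re_sq_add_im_sq_lt_one ht
    have hy : |t.im| < 1 := by rw [← sq_lt_one_iff_abs_lt_one]; nlinarith
    have hx : |t.re| < 1 := by rw [← sq_lt_one_iff_abs_lt_one]; nlinarith
    rw [abs_lt] at hx hy
    have hs := (mul_eq_zero.1 hi).resolve_left (Real.exp_pos _).ne'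
    have hpi := Real.pi_gt_three
    rw [Real.sin_eq_zero_iff_of_lt_of_lt (by linarith) (by linarith)] at hs
    rw [hs, Real.cos_zero, mul_one] at hr
    have := Real.exp_lt_exp.2 hx.1
    linarith

/-! ### Sine -/

theorem sin_one_bounds : 0.841469 < Real.sin 1 ∧ Real.sin 1 < 0.841472 := by
  -- `sin 1` is the imaginary part of `eⁱ`; ten Taylor terms leave an error of about `3 · 10⁻⁷`.
  have h := Complex.exp_bound (x := Complex.I) (by simp) (n := 10) (by norm_num)
  have h2 := (Complex.abs_im_le_norm _).trans h
  have e : (Complex.exp Complex.I).im = Real.sin 1 := by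
    have := Complex.exp_ofReal_mul_I_im 1
    simpa using this
  rw [Complex.sub_im, e] at h2
  have i2 := Complex.I_sq
  have i3 : Complex.I ^ 3 = -Complex.I := by rw [pow_succ, i2]; ring
  have i4 := Complex.I_pow_four
  have i5 : Complex.I ^ 5 = Complex.I := by rw [pow_succ, i4]; ring
  have i6 : Complex.I ^ 6 = -1 := by rw [pow_succ, i5, Complex.I_mul_I]
  have i7 : Complex.I ^ 7 = -Complex.I := by rw [pow_succ, i6]; ring
  have i8 : Complex.I ^ 8 = 1 := by rw [pow_succ, i7, neg_mul, Complex.I_mul_I, neg_neg]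
  have i9 : Complex.I ^ 9 = Complex.I := by rw [pow_succ, i8]; ring
  have e2 : (∑ m ∈ Finset.range 10, Complex.I ^ m / (m.factorial : ℂ)).im =
      1 - 1 / 6 + 1 / 120 - 1 / 5040 + 1 / 362880 := by
    simp only [Finset.sum_range_succ, Finset.sum_range_zero, Complex.add_im]
    simp only [pow_zero, pow_one, i2, i3, i4, i5, i6, i7, i8, i9]
    norm_num [Nat.factorial]
  rw [e2, abs_le] at h2
  norm_num [Nat.factorial] at h2
  constructor <;> linarith [h2.1, h2.2]

/-- `sin² 1 - sin² x = sin (1 - x) sin (1 + x) ≤ (1 - x)(1 + x)`. -/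
theorem sq_sub_sin_sq_le {x : ℝ} (hx : |x| ≤ 1) :
    Real.sin 1 ^ 2 ≤ Real.sin x ^ 2 + (1 - x ^ 2) := by
  rw [abs_le] at hx
  have hpi := Real.pi_gt_three
  have e : Real.sin 1 ^ 2 - Real.sin x ^ 2 = Real.sin (1 - x) * Real.sin (1 + x) := by
    rw [Real.sin_sub, Real.sin_add]
    nlinarith [Real.sin_sq_add_cos_sq 1, Real.sin_sq_add_cos_sq x]
  have h1 := Real.sin_le (show 0 ≤ 1 - x by linarith)
  have h2 := Real.sin_le (show 0 ≤ 1 + x by linarith)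
  have h3 := Real.sin_nonneg_of_nonneg_of_le_pi (show 0 ≤ 1 + x by linarith) (by linarith)
  nlinarith [mul_le_mul h1 h2 h3 (by linarith)]

theorem norm_sin_sq (t : ℂ) : ‖Complex.sin t‖ ^ 2 = Real.sin t.re ^ 2 + Real.sinh t.im ^ 2 := by
  rw [norm_sq_eq_re_sq_add_im_sq, Complex.sin_eq]
  simp only [← Complex.ofReal_sin, ← Complex.ofReal_cos, ← Complex.ofReal_sinh,
    ← Complex.ofReal_cosh, Complex.add_re, Complex.add_im, ← Complex.ofReal_mul,
    Complex.re_ofReal_mul, Complex.im_ofReal_mul, Complex.ofReal_re, Complex.ofReal_im,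
    Complex.I_re, Complex.I_im]
  have h1 := Real.cosh_sq t.im
  have h2 := Real.sin_sq_add_cos_sq t.re
  linear_combination Real.sin t.re ^ 2 * h1 + Real.sinh t.im ^ 2 * h2

/-- With `t = x + iy`, `|sin t|² = sin² x + sinh² y` and `sinh² y ≥ y² ≥ 1 - x²`, so the previous
estimate applies for `|x| ≤ 1`. Beyond that `sin |x| ≥ sin 1` within the strip. Thus an inverse sine
valued in the strip maps `|u| < sin 1` into the unit disk. -/
theorem sin_one_le_norm_sin {t : ℂ} (ht : |t.re| ≤ Real.pi / 2) (h : 1 ≤ ‖t‖) :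
    Real.sin 1 ≤ ‖Complex.sin t‖ := by
  have h1 : 1 ≤ t.re ^ 2 + t.im ^ 2 := by
    rw [← norm_sq_eq_re_sq_add_im_sq]
    exact one_le_pow₀ h
  have hs : 0 ≤ Real.sin 1 := by linarith [sin_one_bounds.1]
  refine le_of_sq_le_sq ?_ (norm_nonneg _)
  rw [norm_sin_sq]
  have hpi := Real.pi_gt_three
  rcases le_or_gt |t.re| 1 with hx | hx
  · have h2 := sq_sub_sin_sq_le hx
    have h3 : t.im ^ 2 ≤ Real.sinh t.im ^ 2 := by
      rw [sq_le_sq, Real.abs_sinh]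
      exact Real.self_le_sinh_iff.2 (abs_nonneg _)
    linarith
  · have h2 : Real.sin 1 ≤ Real.sin |t.re| :=
      Real.sin_le_sin_of_le_of_le_pi_div_two (by linarith) ht hx.le
    have h3 : Real.sin |t.re| ^ 2 = Real.sin t.re ^ 2 := by
      rcases abs_choice t.re with h | h <;> rw [h]
      rw [Real.sin_neg, neg_sq]
    nlinarith [sq_nonneg (Real.sinh t.im)]

/-- An inverse of the sine near `0`. -/
theorem exists_sin_inverse : ∃ g : ℂ → ℂ, g 0 = 0 ∧ ∀ u ∈ diskD, DifferentiableAt ℂ g u ∧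
    Complex.sin (g u) = u ∧ |(g u).re| ≤ Real.pi / 2 := by
  refine ⟨fun u => -Complex.I * Complex.log (Complex.I * u + (1 - u ^ 2) ^ (1 / 2 : ℂ)),
    by simp, fun u hu => ?_⟩
  have hsl : 1 - u ^ 2 ∈ Complex.slitPlane := by
    have := one_add_sq_mem_slitPlane (I_mul_mem_diskD hu)
    rwa [mul_pow, Complex.I_sq, neg_one_mul, ← sub_eq_add_neg] at this
  have hS := re_cpow_half_pos hsl
  have hS2 := cpow_half_sq (1 - u ^ 2)
  have hprod : (Complex.I * u + (1 - u ^ 2) ^ (1 / 2 : ℂ)) *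
      ((1 - u ^ 2) ^ (1 / 2 : ℂ) - Complex.I * u) = 1 := by
    linear_combination hS2 - u ^ 2 * Complex.I_sq
  have hq := re_pos_of_mul_eq_one hprod (by
    rw [show ∀ a b : ℂ, a + b + (b - a) = b + b from fun a b => by ring, Complex.add_re]
    linarith)
  have hd : DifferentiableAt ℂ (fun u : ℂ => (1 - u ^ 2) ^ (1 / 2 : ℂ)) u :=
    differentiableAt_cpow_half (f := fun u => 1 - u ^ 2) (by fun_prop) hsl
  refine ⟨?_, ?_, ?_⟩
  · exact (((differentiableAt_fun_id.const_mul Complex.I).fun_add hd).clog (Or.inl hq)).const_mul _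
  · set q := Complex.I * u + (1 - u ^ 2) ^ (1 / 2 : ℂ) with hqdef
    have hq0 : q ≠ 0 := left_ne_zero_of_mul_eq_one hprod
    have e1 : -Complex.I * Complex.log q * Complex.I = Complex.log q := by
      linear_combination -Complex.log q * Complex.I_sq
    have e2 : -(-Complex.I * Complex.log q) * Complex.I = -Complex.log q := by
      linear_combination Complex.log q * Complex.I_sq
    rw [Complex.sin, e1, e2, Complex.exp_neg, Complex.exp_log hq0,
      ← eq_inv_of_mul_eq_one_right hprod, hqdef]
    linear_combination -u * Complex.I_sq
  · have e : (-Complex.I * Complex.log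
        (Complex.I * u + (1 - u ^ 2) ^ (1 / 2 : ℂ))).re = Complex.arg
        (Complex.I * u + (1 - u ^ 2) ^ (1 / 2 : ℂ)) := by
      rw [← Complex.log_im]
      simp
    rw [e]
    exact Complex.abs_arg_le_pi_div_two_iff.2 hq.le

theorem radius_classSSin : ∃ R : ℝ, R = Real.sin 1 / (2 + Real.sin 1) ∧ |R - 0.296139| < 5e-7 ∧
    IsClassRadius classSSin classK3 R ∧ IsExtremalAt classSSin classK3 R extremalKoebe := by
  obtain ⟨hlo, hhi⟩ := sin_one_bounds
  set S := Real.sin 1 with hSdef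
  set R : ℝ := S / (2 + S) with hR
  have hR0 : 0.2961385 < R := by
    rw [hR, lt_div_iff₀ (by linarith)]
    linarith
  have hR1 : R < 0.2961395 := by
    rw [hR, div_lt_iff₀ (by linarith)]
    linarith
  have hval : (1 + R) / (1 - R) = 1 + S := by
    rw [div_eq_iff (by linarith)]
    have : R * (2 + S) = S := div_mul_cancel₀ _ (by linarith)
    linarith
  refine ⟨R, rfl, ?_, isClassRadius_of_isExtremalAt (by linarith) (by linarith) ?_ ?_⟩
  · rw [abs_lt]
    constructor <;> linarith
  · obtain ⟨g, hg0, hg⟩ := exists_sin_inverse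
    refine dilatesInto_starClass (g := fun w => g (w - 1)) (by linarith)
      (Complex.differentiable_sin.const_add 1).differentiableOn (by simpa using hg0) ?_
    intro s hs0 hsR w hw
    have hs1 : s < 1 := by linarith
    have hsum : diskCenter s + diskRadius s < 1 + S := by
      rw [diskCenter_add_diskRadius hs0 hs1, ← hval]
      exact one_add_div_one_sub_lt hsR (by linarith)
    have hn := norm_sub_one_le_of_norm_sub_le (one_le_diskCenter hs0 hs1) hw
    obtain ⟨g1, g2, g3⟩ := hg (w - 1) (mem_diskD.2 (by linarith))
    refine ⟨g1.comp (f := fun w => w - 1) w (by fun_prop), ?_, by rw [g2]; ring⟩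
    by_contra! h
    have := sin_one_le_norm_sin g3 h
    rw [g2] at this
    linarith
  · refine isExtremalAt_extremalKoebe (by linarith) fun v hv t ht h => ?_
    rw [hval] at hv
    have hsin : Complex.sin t = ((v - 1 : ℝ) : ℂ) := by
      push_cast
      linear_combination h
    have ht1 := re_sq_add_im_sq_lt_one ht
    have hx : |t.re| < 1 := by rw [← sq_lt_one_iff_abs_lt_one]; nlinarith
    rw [abs_lt] at hx
    have hpi := Real.pi_gt_three
    rw [Complex.sin_eq] at hsin
    have hr := congrArg Complex.re hsin
    have hi := congrArg Complex.im hsin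
    simp only [← Complex.ofReal_sin, ← Complex.ofReal_cos, ← Complex.ofReal_sinh,
      ← Complex.ofReal_cosh, Complex.add_re, Complex.add_im, ← Complex.ofReal_mul,
      Complex.re_ofReal_mul, Complex.im_ofReal_mul, Complex.ofReal_re, Complex.ofReal_im,
      Complex.I_re, Complex.I_im, mul_zero, mul_one, add_zero, zero_add] at hr hi
    have hcos : 0 < Real.cos t.re := Real.cos_pos_of_mem_Ioo ⟨by linarith, by linarith⟩
    have hy : t.im = 0 := Real.sinh_eq_zero.1 ((mul_eq_zero.1 hi).resolve_left hcos.ne')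
    rw [hy, Real.cosh_zero, mul_one] at hr
    have : Real.sin t.re ≤ Real.sin 1 :=
      Real.sin_le_sin_of_le_of_le_pi_div_two (by linarith) (by linarith) hx.2.le
    linarith

/-! ### Rational function -/

theorem abs_im_lt_re_of_re_sq_pos {z : ℂ} (hz : 0 < (z ^ 2).re) (h : 0 < z.re) : |z.im| < z.re := by
  rw [pow_two, Complex.mul_re] at hz
  exact abs_lt_of_sq_lt_sq (by nlinarith) h.le

theorem radius_classSR : ∃ R : ℝ,
    IsLeastPosRoot
      (fun r => r ^ 4 + 2 * r ^ 3 + 2 * r ^ 2 + 2 * r - 3 + 2 * √2 * (1 - r ^ 4) = 0) R ∧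
    |R - 0.0790749| < 5e-8 ∧ IsClassRadius classSR classK3 R ∧
    IsExtremalAt classSR classK3 R extremalF3 := by
  have h2 : √2 ^ 2 = 2 := Real.sq_sqrt (by norm_num)
  have hlo : 1.4142135623 < √2 := Real.lt_sqrt_of_sq_lt (by norm_num)
  have hhi : √2 < 1.4142135624 := (Real.sqrt_lt' (by norm_num)).2 (by norm_num)
  obtain ⟨R, hR0, hR1, hroot, hin, hout⟩ := exists_leftRadius (m := 2 * √2 - 2)
    (lo := 0.07907486) (hi := 0.07907494)
    (eq := fun r => r ^ 4 + 2 * r ^ 3 + 2 * r ^ 2 + 2 * r - 3 + 2 * √2 * (1 - r ^ 4) = 0)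
    (by linarith) (by norm_num) (by norm_num) (by norm_num) (by norm_num; linarith)
    (by norm_num; linarith)
    (fun r => by constructor <;> intro h <;> linarith)
  set k : ℝ := √2 + 1 with hk
  have hk1 : 2.414 < k := by rw [hk]; linarith
  have hk3 : k < 2.415 := by rw [hk]; linarith
  have hk0 : (k : ℂ) ≠ 0 := by
    have : k ≠ 0 := by linarith
    exact_mod_cast this
  have hden : ∀ z ∈ diskD, (k : ℂ) - z ≠ 0 := by
    intro z hz h
    have hz := mem_diskD.1 hz
    rw [← sub_eq_zero.1 h, Complex.norm_real, Real.norm_of_nonneg (by linarith)] at hz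
    linarith
  have hden2 : ∀ z ∈ diskD, (k : ℂ) ^ 2 - k * z ≠ 0 := by
    intro z hz
    rw [show (k : ℂ) ^ 2 - k * z = k * (k - z) by ring]
    exact mul_ne_zero hk0 (hden z hz)
  refine ⟨R, hroot, by rw [abs_lt]; constructor <;> linarith,
    isClassRadius_of_isExtremalAt (by linarith) (by linarith) ?_ ?_⟩
  -- Solving `h(z) = w` gives `z² + k w z + k² (1 - w) = 0`, with discriminant `k² (w² + 4w - 4)`.
  -- Taking the roots of its two linear factors separately keeps the square root analytic.
  · refine dilatesInto_starClass (g := fun w => (k : ℂ) / 2 *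
      ((w + ((2 - 2 * √2 : ℝ) : ℂ)) ^ (1 / 2 : ℂ) * (w + ((2 + 2 * √2 : ℝ) : ℂ)) ^ (1 / 2 : ℂ) - w))
      (by linarith) ?_ ?_ ?_
    · exact (DifferentiableOn.div (by fun_prop) (by fun_prop) hden2).const_add 1
    · have e1 : (1 : ℂ) + ((2 - 2 * √2 : ℝ) : ℂ) = ((√2 - 1 : ℝ) : ℂ) ^ 2 := by
        norm_cast
        linear_combination -h2
      have e2 : (1 : ℂ) + ((2 + 2 * √2 : ℝ) : ℂ) = ((√2 + 1 : ℝ) : ℂ) ^ 2 := by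
        norm_cast
        linear_combination -h2
      rw [e1, e2, sq_cpow_half (by rw [Complex.ofReal_re]; linarith),
        sq_cpow_half (by rw [Complex.ofReal_re]; linarith), ← Complex.ofReal_mul,
        show (√2 - 1) * (√2 + 1) = 1 by linear_combination h2]
      simp
    · intro s hs0 hsR w hw
      obtain ⟨h1, h4, -⟩ := re_im_bounds_of_norm_sub_le hw
      have h3 := hin s hs0 (by linarith)
      have hc := one_le_diskCenter hs0 (by linarith)
      have ha := diskRadius_nonneg hs0 (by linarith)
      have hc2 := diskCenter_le_of_le (C := 1.001) hs0 (by linarith : s ≤ 0.08) (by norm_num)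
        (by norm_num [diskCenter])
      have hre : 2 * √2 - 2 < w.re := by linarith
      have p1 : 0 < (w + ((2 - 2 * √2 : ℝ) : ℂ)).re := by
        rw [Complex.add_re, Complex.ofReal_re]; linarith
      have p2 : 0 < (w + ((2 + 2 * √2 : ℝ) : ℂ)).re := by
        rw [Complex.add_re, Complex.ofReal_re]; linarith
      have q1 := re_cpow_half_pos (mem_slitPlane_of_re_pos p1)
      have q2 := re_cpow_half_pos (mem_slitPlane_of_re_pos p2)
      have r1 := cpow_half_sq (w + ((2 - 2 * √2 : ℝ) : ℂ))
      have r2 := cpow_half_sq (w + ((2 + 2 * √2 : ℝ) : ℂ))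
      have d1 := differentiableAt_cpow_half (f := fun w => w + ((2 - 2 * √2 : ℝ) : ℂ)) (z := w)
        (by fun_prop) (mem_slitPlane_of_re_pos p1)
      have d2 := differentiableAt_cpow_half (f := fun w => w + ((2 + 2 * √2 : ℝ) : ℂ)) (z := w)
        (by fun_prop) (mem_slitPlane_of_re_pos p2)
      refine (and_iff_right
        (((d1.fun_mul d2).fun_sub differentiableAt_fun_id).const_mul _)).2 ?_
      set σ₁ := (w + ((2 - 2 * √2 : ℝ) : ℂ)) ^ (1 / 2 : ℂ)
      set σ₂ := (w + ((2 + 2 * √2 : ℝ) : ℂ)) ^ (1 / 2 : ℂ)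
      have i1 := abs_im_lt_re_of_re_sq_pos (by rwa [r1]) q1
      have i2 := abs_im_lt_re_of_re_sq_pos (by rwa [r2]) q2
      -- Each root has argument less than `π/4` in absolute value.
      have hSre : 0 < (σ₁ * σ₂).re := by
        rw [Complex.mul_re, sub_pos]
        calc σ₁.im * σ₂.im ≤ |σ₁.im| * |σ₂.im| := by rw [← abs_mul]; exact le_abs_self _
          _ < σ₁.re * σ₂.re := mul_lt_mul'' i1 i2 (abs_nonneg _) (abs_nonneg _)
      have h2c : ((√2 : ℝ) : ℂ) ^ 2 = 2 := by exact_mod_cast h2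
      have hS2 : (σ₁ * σ₂) ^ 2 = w ^ 2 + 4 * w - 4 := by
        rw [mul_pow, r1, r2]
        push_cast
        linear_combination -4 * h2c
      set S := σ₁ * σ₂ with hS
      have hlt : ‖(k : ℂ) / 2 * (S - w)‖ < 1 := by
        have e : (k : ℂ) / 2 * (S - w) * (S + w) = ((2 * k : ℝ) : ℂ) * (w - 1) := by
          push_cast
          linear_combination (k : ℂ) / 2 * hS2
        have e2 := congrArg norm e
        rw [norm_mul _ (S + w), norm_mul _ (w - 1), Complex.norm_real,
          Real.norm_of_nonneg (by linarith)] at e2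
        -- As `S² - w² = 4 (w - 1)` and `|S + w| > Re w`, this is enough for `|g w| < 1`. Equality
        -- holds at `w = m`; away from `m` the slack `(x - m)(x + m)` in `x² - m²`, with `x = Re w`,
        -- absorbs the error from `c - 1`.
        have hb : 2 * k * ‖w - 1‖ < w.re := by
          refine lt_of_pow_lt_pow_left₀ 2 (by linarith) ?_
          rw [mul_pow, norm_sq_eq_re_sq_add_im_sq]
          simp only [Complex.sub_re, Complex.sub_im, Complex.one_re, Complex.one_im, sub_zero]
          set m := 2 * √2 - 2 with hm
          have a1 : (w.re - 1) ^ 2 + w.im ^ 2 ≤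
              (1 - m) ^ 2 + 2 * (diskCenter s - 1) * (w.re - m) := by
            have : diskRadius s ^ 2 ≤ (diskCenter s - m) ^ 2 :=
              pow_le_pow_left₀ ha (by linarith) 2
            linarith
          have a2 : (2 * k) ^ 2 * (1 - m) ^ 2 = m ^ 2 := by
            have : 2 * k * (1 - m) = m := by
              rw [hk, hm]
              linear_combination -4 * h2
            rw [← mul_pow, this]
          have a3 : (2 * k) ^ 2 ≤ 24 := by nlinarith
          have a4 : (2 * k) ^ 2 * (2 * (diskCenter s - 1) * (w.re - m)) ≤ w.re - m := by
            have h5 : (2 * k) ^ 2 * (2 * (diskCenter s - 1)) ≤ 24 * (2 * 0.001) :=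
              mul_le_mul a3 (by linarith) (by linarith) (by norm_num)
            rw [← mul_assoc]
            exact mul_le_of_le_one_left (by linarith) (h5.trans (by norm_num))
          have a5 := mul_le_mul_of_nonneg_left a1 (sq_nonneg (2 * k))
          have a6 : w.re - m < (w.re - m) * (w.re + m) := by
            exact lt_mul_of_one_lt_right (by linarith) (by linarith)
          calc (2 * k) ^ 2 * ((w.re - 1) ^ 2 + w.im ^ 2) ≤ m ^ 2 + (w.re - m) := by linarith
            _ < m ^ 2 + (w.re - m) * (w.re + m) := by linarith
            _ = w.re ^ 2 := by ring
        have hge : w.re < ‖S + w‖ := by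
          refine lt_of_lt_of_le ?_ (Complex.re_le_norm _)
          rw [Complex.add_re]
          linarith
        by_contra! hcon
        have := le_mul_of_one_le_left (norm_nonneg (S + w)) hcon
        linarith
      refine ⟨hlt, ?_⟩
      have hd := hden2 _ (mem_diskD.2 hlt)
      rw [← hk, ← eq_sub_iff_add_eq', div_eq_iff hd]
      linear_combination (k : ℂ) ^ 2 / 4 * hS2
  · refine isExtremalAt_extremalF3 (by linarith) hout fun v hv t ht h => ?_
    have hd := hden2 t ht
    rw [← hk, ← eq_sub_iff_add_eq', div_eq_iff hd] at h
    have ht1 := re_sq_add_im_sq_lt_one ht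
    have h' : t * t + (k : ℂ) * (v * t) + ((k ^ 2 * (1 - v) : ℝ) : ℂ) = 0 := by
      push_cast
      linear_combination h
    have hr := congrArg Complex.re h'
    have hi := congrArg Complex.im h'
    simp only [Complex.add_re, Complex.add_im, Complex.mul_re, Complex.mul_im, Complex.ofReal_re, Complex.ofReal_im,
      Complex.zero_re, Complex.zero_im, add_zero] at hr hi
    have hi' : t.im * (2 * t.re + k * v) = 0 := by linear_combination hi
    have hkm : k ^ 2 * (3 - 2 * √2) = 1 := by
      rw [hk]
      linear_combination (-1 - 2 * √2) * h2
    have hprod : 1 < k ^ 2 * (1 - v) := by nlinarith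
    -- For non-real `t` the conjugate is the other root, so `|t|² = k² (1 - v) > 1`. For real `t`
    -- the equation becomes `(t + 1)² = k (m - v)(t - k)`, with negative right side.
    rcases mul_eq_zero.1 hi' with hy | hx
    · rw [hy] at hr ht1
      have hx := abs_lt.1 ((sq_lt_one_iff_abs_lt_one t.re).1 (by nlinarith))
      have hkm2 : k * (2 * √2 - 2) = 2 := by
        rw [hk]
        linear_combination 2 * h2
      have e : (t.re + 1) ^ 2 = k * (2 * √2 - 2 - v) * (t.re - k) := by
        linear_combination hr - t.re * hkm2 - hkm
      have : 0 < k * (2 * √2 - 2 - v) := mul_pos (by linarith) (by linarith)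
      nlinarith [sq_nonneg (t.re + 1)]
    · have : t.re ^ 2 + t.im ^ 2 = k ^ 2 * (1 - v) := by
        linear_combination -hr + t.re * hx
      linarith

/-! ### Reverse lemniscate -/

/-- With `N = x² + y² + 1` the disk reads `N - κ < 2bx` and the lemniscate reads `N² - 1 < 4x²`.
They are linked by `(N - κ)² - b² (N² - 1) = (κN - 1)² ≥ 0`. -/
theorem reverseLemniscate_of_disk {x y b κ : ℝ} (hb0 : 0 < b) (hκ0 : 0 ≤ κ)
    (hbκ : b ^ 2 = 1 - κ ^ 2) (h : (x - b) ^ 2 + y ^ 2 < κ - κ ^ 2) :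
    0 < x ∧ (x ^ 2 + y ^ 2) ^ 2 < 2 * (x ^ 2 - y ^ 2) := by
  set N := x ^ 2 + y ^ 2 + 1 with hN
  have hκ1 : κ ≤ 1 := (sq_le_one_iff₀ hκ0).1 (by linarith [sq_nonneg b])
  have hN1 : N - κ < 2 * b * x := by
    rw [hN]
    linarith
  have hNκ : 0 ≤ N - κ := by
    have : 0 ≤ x ^ 2 + y ^ 2 := by positivity
    linarith
  refine ⟨(mul_pos_iff_of_pos_left (by linarith : 0 < 2 * b)).1 (hNκ.trans_lt hN1), ?_⟩
  have k1 : b ^ 2 * (N ^ 2 - 1) ≤ (N - κ) ^ 2 := by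
    rw [hbκ]
    linarith [sq_nonneg (κ * N - 1)]
  have k2 : (N - κ) ^ 2 < (2 * b * x) ^ 2 := pow_lt_pow_left₀ hN1 hNκ two_ne_zero
  have k3 : b ^ 2 * (N ^ 2 - 1) < b ^ 2 * (4 * x ^ 2) := by linarith
  have k4 := lt_of_mul_lt_mul_left k3 (by positivity)
  rw [hN] at k4
  linarith

/-- The inverse of `√2 - (√2 - 1) √((1 - z) / (1 + 2 (√2 - 1) z))`. -/
theorem reverseLemniscate_inverse {σ : ℝ} (h2 : σ ^ 2 = 2) (hσ : 1 < σ) {w : ℂ}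
    (hx : 0 < σ - w.re)
    (h : ((σ - w.re) ^ 2 + w.im ^ 2) ^ 2 < 2 * ((σ - w.re) ^ 2 - w.im ^ 2)) :
    DifferentiableAt ℂ (fun w : ℂ => (1 - (((σ : ℂ) - w) / ((σ - 1 : ℝ) : ℂ)) ^ 2) /
      (1 + 2 * ((σ - 1 : ℝ) : ℂ) * (((σ : ℂ) - w) / ((σ - 1 : ℝ) : ℂ)) ^ 2)) w ∧
    ‖(1 - (((σ : ℂ) - w) / ((σ - 1 : ℝ) : ℂ)) ^ 2) /
      (1 + 2 * ((σ - 1 : ℝ) : ℂ) * (((σ : ℂ) - w) / ((σ - 1 : ℝ) : ℂ)) ^ 2)‖ < 1 ∧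
    (σ : ℂ) - ((σ - 1 : ℝ) : ℂ) *
      ((1 - (1 - (((σ : ℂ) - w) / ((σ - 1 : ℝ) : ℂ)) ^ 2) /
        (1 + 2 * ((σ - 1 : ℝ) : ℂ) * (((σ : ℂ) - w) / ((σ - 1 : ℝ) : ℂ)) ^ 2)) /
      (1 + 2 * ((σ - 1 : ℝ) : ℂ) * ((1 - (((σ : ℂ) - w) / ((σ - 1 : ℝ) : ℂ)) ^ 2) /
        (1 + 2 * ((σ - 1 : ℝ) : ℂ) * (((σ : ℂ) - w) / ((σ - 1 : ℝ) : ℂ)) ^ 2)))) ^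
          (1 / 2 : ℂ) = w := by
  set x := σ - w.re
  set y := w.im
  set δ := σ - 1 with hδdef
  have hδ0 : 0 < δ := by linarith
  have hδ : (δ : ℂ) ≠ 0 := by exact_mod_cast hδ0.ne'
  -- This identity turns `|1 - U| < |1 + 2δU|`, `U = ζ²`, into `δ² |U|² < 2 Re U`, the lemniscate
  -- condition: expand and divide by `1 + 2δ`.
  have hδ2 : δ ^ 2 = 1 - 2 * δ := by
    rw [hδdef]
    linear_combination h2
  have hζre : (((σ : ℂ) - w) / (δ : ℂ)).re = x / δ := by
    rw [Complex.div_ofReal_re, Complex.sub_re, Complex.ofReal_re]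
  have hζim : (((σ : ℂ) - w) / (δ : ℂ)).im = -y / δ := by
    rw [Complex.div_ofReal_im, Complex.sub_im, Complex.ofReal_im, zero_sub]
  have hζw : (δ : ℂ) * (((σ : ℂ) - w) / (δ : ℂ)) = σ - w := mul_div_cancel₀ _ hδ
  set ζ := ((σ : ℂ) - w) / (δ : ℂ) with hζ
  have hζpos : 0 < ζ.re := by
    rw [hζre]
    positivity
  have hUre : (ζ ^ 2).re = (x ^ 2 - y ^ 2) / δ ^ 2 := by
    rw [pow_two, Complex.mul_re, hζre, hζim]
    field_simp
  have hUim : (ζ ^ 2).im = -(2 * x * y) / δ ^ 2 := by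
    rw [pow_two, Complex.mul_im, hζre, hζim]
    field_simp
    ring
  have hUU : δ ^ 2 * ((ζ ^ 2).re ^ 2 + (ζ ^ 2).im ^ 2) < 2 * (ζ ^ 2).re := by
    have e : δ ^ 2 * ((ζ ^ 2).re ^ 2 + (ζ ^ 2).im ^ 2) = (x ^ 2 + y ^ 2) ^ 2 / δ ^ 2 := by
      rw [hUre, hUim]
      field_simp
      ring
    rw [e, hUre, ← mul_div_assoc]
    exact div_lt_div_of_pos_right h (by positivity)
  have hden : 1 + 2 * (δ : ℂ) * ζ ^ 2 ≠ 0 := by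
    intro h
    have hr := congrArg Complex.re h
    rw [show 2 * (δ : ℂ) * ζ ^ 2 = ((2 * δ : ℝ) : ℂ) * ζ ^ 2 by push_cast; ring, Complex.add_re,
      Complex.re_ofReal_mul, Complex.one_re, Complex.zero_re] at hr
    have : 0 ≤ (ζ ^ 2).re := by
      have : 0 ≤ δ ^ 2 * ((ζ ^ 2).re ^ 2 + (ζ ^ 2).im ^ 2) := by positivity
      linarith
    nlinarith
  refine ⟨?_, ?_, ?_⟩
  · exact DifferentiableAt.div (by fun_prop) (by fun_prop) hden
  · rw [norm_div, div_lt_one (norm_pos_iff.2 hden)]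
    refine lt_of_pow_lt_pow_left₀ 2 (norm_nonneg _) ?_
    rw [norm_sq_eq_re_sq_add_im_sq, norm_sq_eq_re_sq_add_im_sq,
      show 2 * (δ : ℂ) * ζ ^ 2 = ((2 * δ : ℝ) : ℂ) * ζ ^ 2 by push_cast; ring]
    simp only [Complex.sub_re, Complex.one_re, Complex.add_re, Complex.re_ofReal_mul,
      Complex.sub_im, Complex.one_im, Complex.add_im, Complex.im_ofReal_mul]
    rw [hδ2] at hUU
    nlinarith [mul_lt_mul_of_pos_left hUU (show 0 < 1 + 2 * δ by linarith)]
  · have hδc : 1 + 2 * (δ : ℂ) ≠ 0 := by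
      have : 1 + 2 * δ ≠ 0 := by linarith
      exact_mod_cast this
    have e : (1 - (1 - ζ ^ 2) / (1 + 2 * (δ : ℂ) * ζ ^ 2)) /
        (1 + 2 * (δ : ℂ) * ((1 - ζ ^ 2) / (1 + 2 * (δ : ℂ) * ζ ^ 2))) = ζ ^ 2 := by
      have e1 : 1 - (1 - ζ ^ 2) / (1 + 2 * (δ : ℂ) * ζ ^ 2) =
          ζ ^ 2 * (1 + 2 * (δ : ℂ)) / (1 + 2 * (δ : ℂ) * ζ ^ 2) := by
        rw [eq_div_iff hden, sub_mul, div_mul_cancel₀ _ hden]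
        ring
      have e2 : 1 + 2 * (δ : ℂ) * ((1 - ζ ^ 2) / (1 + 2 * (δ : ℂ) * ζ ^ 2)) =
          (1 + 2 * (δ : ℂ)) / (1 + 2 * (δ : ℂ) * ζ ^ 2) := by
        rw [eq_div_iff hden, add_mul, mul_assoc (2 * (δ : ℂ)), div_mul_cancel₀ _ hden]
        ring
      rw [e1, e2, div_div_div_cancel_right₀ hden, mul_div_cancel_right₀ _ hδc]
    rw [e, sq_cpow_half hζpos, hζw]
    ring

theorem radius_classSRL : ∃ R : ℝ,
    IsLeastPosRoot
      (fun r =>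
        (1 - r ^ 4) * √((1 - r ^ 4) ^ 2 - ((√2 - 1) - (√2 + 1) * r ^ 4) ^ 2) =
          (2 * r ^ 3 + 2 * r ^ 2 + 2 * r) ^ 2 + (1 - r ^ 4) ^ 2 -
            ((√2 - 1) - (√2 + 1) * r ^ 4) ^ 2) R ∧
    |R - 0.125145| < 5e-7 ∧ DilatesInto classSRL classK3 R := by
  have h2 : √2 ^ 2 = 2 := Real.sq_sqrt (by norm_num)
  have hlo : 1.41421356237 < √2 := Real.lt_sqrt_of_sq_lt (by norm_num)
  have hhi : √2 < 1.41421356238 := (Real.sqrt_lt' (by norm_num)).2 (by norm_num)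
  set σ := √2 with hσ
  -- With `A = 1 - r⁴`, so that `A² - B² = P`, the equation is `A √P = T² + P`. Squared, it becomes
  -- `P (B² - 2T²) - T⁴ = 0`; up to `R`, `P` and `B` decrease and `T` increases, so there is no
  -- earlier root.
  set P : ℝ → ℝ := fun r => (2 * σ - 2) - (2 * σ + 2) * (r ^ 4) ^ 2 with hP
  set B : ℝ → ℝ := fun r => (σ - 1) - (σ + 1) * r ^ 4 with hB
  set T : ℝ → ℝ := fun r => 2 * r ^ 3 + 2 * r ^ 2 + 2 * r with hT
  have hPB : ∀ r : ℝ, (1 - r ^ 4) ^ 2 - ((σ - 1) - (σ + 1) * r ^ 4) ^ 2 = P r := by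
    intro r
    simp only [hP]
    linear_combination (-1 + 2 * r ^ 4 - (r ^ 4) ^ 2) * h2
  -- The root lies within `5 · 10⁻⁸` of the rounding edge `0.1251455`, hence the tight bracket.
  have hc : ContinuousOn (fun r => P r * (B r ^ 2 - 2 * T r ^ 2) - T r ^ 4)
      (Set.Icc 0.12514545 0.1251454999) := by
    simp only [hP, hB, hT]
    fun_prop
  obtain ⟨R, ⟨hR1, hR2⟩, hR⟩ := intermediate_value_Ioo' (by norm_num) hc
    (show (0 : ℝ) ∈ Set.Ioo _ _ by
      simp only [hP, hB, hT]
      constructor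
      · norm_num
        nlinarith
      · norm_num
        nlinarith)
  beta_reduce at hR
  have hq : ∀ r, 0 ≤ r → r ≤ R → r ^ 4 ≤ 0.0003 := by
    intro r hr0 hr
    calc r ^ 4 ≤ 0.126 ^ 4 := pow_le_pow_left₀ hr0 (by linarith) 4
      _ ≤ 0.0003 := by norm_num
  have hPpos : ∀ r, 0 ≤ r → r ≤ R → 0 < P r := by
    intro r hr0 hr
    have := hq r hr0 hr
    have : (r ^ 4) ^ 2 ≤ 0.0003 := by nlinarith [pow_nonneg hr0 4]
    simp only [hP]
    nlinarith
  have hBpos : ∀ r, 0 ≤ r → r ≤ R → 0 < B r := by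
    intro r hr0 hr
    have := hq r hr0 hr
    simp only [hB]
    nlinarith
  have hT0 : ∀ r, 0 ≤ r → 0 ≤ T r := by
    intro r hr0
    simp only [hT]
    positivity
  have hpos : ∀ r, 0 ≤ r → r < R → 0 < P r * (B r ^ 2 - 2 * T r ^ 2) - T r ^ 4 := by
    intro r hr0 hr
    have hT1 : T r < T R := by
      simp only [hT]
      have := pow_lt_pow_left₀ hr hr0 (n := 3) (by norm_num)
      have := pow_lt_pow_left₀ hr hr0 (n := 2) (by norm_num)
      linarith
    have h4 : r ^ 4 ≤ R ^ 4 := pow_le_pow_left₀ hr0 hr.le 4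
    have h8 : (r ^ 4) ^ 2 ≤ (R ^ 4) ^ 2 := pow_le_pow_left₀ (by positivity) h4 2
    have hP1 : P R ≤ P r := by
      exact sub_le_sub_left (mul_le_mul_of_nonneg_left h8 (by linarith)) _
    have hB1 : B R ≤ B r := by
      exact sub_le_sub_left (mul_le_mul_of_nonneg_left h4 (by linarith)) _
    have hPR := hPpos R (by linarith) le_rfl
    have hB2 : B R ^ 2 ≤ B r ^ 2 := pow_le_pow_left₀ (hBpos R (by linarith) le_rfl).le hB1 2
    have hT2 : T r ^ 2 < T R ^ 2 := pow_lt_pow_left₀ hT1 (hT0 r hr0) two_ne_zero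
    have hT4 : T r ^ 4 < T R ^ 4 := pow_lt_pow_left₀ hT1 (hT0 r hr0) (by norm_num)
    have hBT : 0 ≤ B R ^ 2 - 2 * T R ^ 2 := by
      by_contra! hneg
      have := mul_neg_of_pos_of_neg hPR hneg
      have : 0 ≤ T R ^ 4 := by positivity
      linarith
    have := mul_le_mul hP1 (by linarith : B R ^ 2 - 2 * T R ^ 2 ≤ B r ^ 2 - 2 * T r ^ 2) hBT
      (hPpos r hr0 hr.le).le
    linarith
  have hsq : ∀ r, 0 ≤ r → r ≤ R → ((1 - r ^ 4) * √(P r)) ^ 2 - (T r ^ 2 + P r) ^ 2 =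
      P r * (B r ^ 2 - 2 * T r ^ 2) - T r ^ 4 := by
    intro r hr0 hr
    rw [mul_pow, Real.sq_sqrt (hPpos r hr0 hr).le]
    have := hPB r
    simp only [hB]
    linear_combination P r * this
  have hA : ∀ r, 0 ≤ r → r ≤ R → 0 < 1 - r ^ 4 := fun r hr0 hr =>
    one_sub_pow_four_pos hr0 (by linarith)
  refine ⟨R, ⟨⟨by linarith, ?_⟩, fun r ⟨hr0, hr⟩ => ?_⟩,
    by rw [abs_lt]; constructor <;> linarith, ?_⟩
  · beta_reduce
    rw [add_sub_assoc, hPB]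
    have h1 := hsq R (by linarith) le_rfl
    rw [hR, sub_eq_zero] at h1
    have h3 := hA R (by linarith) le_rfl
    have h4 := hPpos R (by linarith) le_rfl
    exact (pow_left_inj₀ (by positivity) (by positivity) two_ne_zero).1 h1
  · by_contra! hlt
    beta_reduce at hr
    rw [add_sub_assoc, hPB] at hr
    have h1 := hsq r hr0.le hlt.le
    rw [show 2 * r ^ 3 + 2 * r ^ 2 + 2 * r = T r from rfl] at hr
    rw [hr, sub_self] at h1
    exact (hpos r hr0.le hlt).ne h1
  have hδ : ((σ - 1 : ℝ) : ℂ) ≠ 0 := by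
    have : σ - 1 ≠ 0 := by linarith
    exact_mod_cast this
  refine dilatesInto_starClass (g := fun w => (1 - (((σ : ℂ) - w) / ((σ - 1 : ℝ) : ℂ)) ^ 2) /
    (1 + 2 * ((σ - 1 : ℝ) : ℂ) * (((σ : ℂ) - w) / ((σ - 1 : ℝ) : ℂ)) ^ 2)) (by linarith) ?_ ?_ ?_
  · intro z hz
    have hz1 := re_sq_add_im_sq_lt_one hz
    have hpos : 0 < ((1 - z) / (1 + 2 * ((σ - 1 : ℝ) : ℂ) * z)).re := by
      apply re_div_pos
      rw [show 2 * ((σ - 1 : ℝ) : ℂ) * z = ((2 * (σ - 1) : ℝ) : ℂ) * z by push_cast; ring]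
      simp only [Complex.sub_re, Complex.one_re, Complex.add_re, Complex.re_ofReal_mul,
        Complex.sub_im, Complex.one_im, Complex.add_im, Complex.im_ofReal_mul]
      have hx := abs_lt.1 ((sq_lt_one_iff_abs_lt_one z.re).1 (by nlinarith))
      nlinarith
    have hne : 1 + 2 * ((σ - 1 : ℝ) : ℂ) * z ≠ 0 := by
      intro h
      rw [h, div_zero, Complex.zero_re] at hpos
      exact lt_irrefl _ hpos
    refine DifferentiableAt.differentiableWithinAt ?_
    refine ((differentiableAt_cpow_half
      (f := fun z => (1 - z) / (1 + 2 * ((σ - 1 : ℝ) : ℂ) * z)) ?_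
      (mem_slitPlane_of_re_pos hpos)).const_mul _).const_sub _
    exact DifferentiableAt.div (by fun_prop) (by fun_prop) hne
  · have : ((σ : ℂ) - 1) / ((σ - 1 : ℝ) : ℂ) = 1 := by
      rw [Complex.ofReal_sub, Complex.ofReal_one] at hδ ⊢
      exact div_self hδ
    rw [this]
    simp
  · intro s hs0 hsR w hw
    obtain ⟨w1, -, -⟩ := re_im_bounds_of_norm_sub_le hw
    have hAs := hA s hs0 hsR.le
    have hPs := hPpos s hs0 hsR.le
    have hBs := hBpos s hs0 hsR.le
    -- `b = √2 - c` is the centre after the reflection `w ↦ √2 - w`, and `κ = √(1 - b²)`. Dividing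
    -- the equation by `A²` turns it into `a² = κ - κ²`.
    set b := B s / (1 - s ^ 4) with hb
    set κ := √(P s) / (1 - s ^ 4) with hκ
    have hb0 : 0 < b := div_pos hBs hAs
    have hκ0 : 0 ≤ κ := div_nonneg (Real.sqrt_nonneg _) hAs.le
    have hbκ : b ^ 2 = 1 - κ ^ 2 := by
      rw [hb, hκ, div_pow, div_pow, Real.sq_sqrt hPs.le, ← hPB s]
      field_simp
      ring
    have hcb : diskCenter s = σ - b := by
      rw [diskCenter, hb]
      field_simp
      simp only [hB]
      ring
    have haT : diskRadius s = T s / (1 - s ^ 4) := by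
      rw [diskRadius]
      simp only [hT]
      ring
    have ha : diskRadius s ^ 2 < κ - κ ^ 2 := by
      have h1 := hsq s hs0 hsR.le
      have h3 := hpos s hs0 hsR
      have h4 : T s ^ 2 + P s < (1 - s ^ 4) * √(P s) :=
        lt_of_pow_lt_pow_left₀ 2 (by positivity) (by linarith)
      have e : κ - κ ^ 2 = ((1 - s ^ 4) * √(P s) - P s) / (1 - s ^ 4) ^ 2 := by
        rw [hκ, div_pow, Real.sq_sqrt hPs.le]
        field_simp
      rw [haT, e, div_pow]
      exact div_lt_div_of_pos_right (by linarith) (by positivity)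
    have hre := reverseLemniscate_of_disk (x := σ - w.re) (y := w.im) hb0 hκ0 hbκ (by
      rw [hcb] at w1
      linarith)
    exact reverseLemniscate_inverse h2 (by linarith) hre.1 hre.2

theorem theorem3 :
    -- the disk containing `z f'(z) / f(z)` on `|z| = r`
    (∀ f ∈ classK3, ∀ z ∈ diskD,
      ‖starQuot f z - (((1 + ‖z‖ ^ 4) / (1 - ‖z‖ ^ 4) : ℝ) : ℂ)‖ ≤
        2 * ‖z‖ * (‖z‖ ^ 2 + ‖z‖ + 1) / (1 - ‖z‖ ^ 4)) ∧
    -- (1) starlike of order `α`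
    (∀ α : ℝ, 0 ≤ α → α < 1 → ∃ R : ℝ,
      IsLeastPosRoot
        (fun r => (1 + α) * r ^ 4 - 2 * r * (r ^ 2 + r + 1) + (1 - α) = 0) R ∧
      IsClassRadius (classSOrder α) classK3 R ∧
      IsExtremalAt (classSOrder α) classK3 R extremalF3) ∧
    -- (2) lemniscate starlike
    (∃ R : ℝ, R = (√2 - 1) / (√2 + 1) ∧ |R - 0.171573| < 5e-7 ∧
      IsClassRadius classSL classK3 R ∧
      IsExtremalAt classSL classK3 R extremalKoebe) ∧
    -- (3) parabolic starlike
    (∃ R : ℝ,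
      IsLeastPosRoot (fun r => 4 * r ^ 3 + 4 * r ^ 2 + 4 * r - 1 - 3 * r ^ 4 = 0) R ∧
      |R - 0.2021347| < 5e-8 ∧
      IsClassRadius classSP classK3 R ∧
      IsExtremalAt classSP classK3 R extremalF3) ∧
    -- (4) exponential
    (∃ R : ℝ,
      IsLeastPosRoot
        (fun r => (2 * r ^ 3 + 2 * r ^ 2 + 2 * r - 1 - r ^ 4) * Real.exp 1 + 1 - r ^ 4 = 0) R ∧
      |R - 0.244259| < 5e-7 ∧
      IsClassRadius classSE classK3 R ∧
      IsExtremalAt classSE classK3 R extremalF3) ∧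
    -- (5) cardioid
    (∃ R : ℝ,
      IsLeastPosRoot (fun r => 3 * r ^ 3 + 3 * r ^ 2 + 3 * r - 1 - 2 * r ^ 4 = 0) R ∧
      |R - 0.254726| < 5e-7 ∧
      IsClassRadius classSC classK3 R ∧
      IsExtremalAt classSC classK3 R extremalF3) ∧
    -- (6) lune
    (∃ R : ℝ,
      IsLeastPosRoot
        (fun r => 2 * r ^ 3 + 2 * r ^ 2 + 2 * r - √2 * r ^ 4 = 2 - √2) R ∧
      |R - 0.229877| < 5e-7 ∧
      IsClassRadius classSMoon classK3 R ∧
      IsExtremalAt classSMoon classK3 R extremalF3) ∧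
    -- (7) sine
    (∃ R : ℝ, R = Real.sin 1 / (2 + Real.sin 1) ∧ |R - 0.296139| < 5e-7 ∧
      IsClassRadius classSSin classK3 R ∧
      IsExtremalAt classSSin classK3 R extremalKoebe) ∧
    -- (8) rational function
    (∃ R : ℝ,
      IsLeastPosRoot
        (fun r => r ^ 4 + 2 * r ^ 3 + 2 * r ^ 2 + 2 * r - 3 + 2 * √2 * (1 - r ^ 4) = 0) R ∧
      |R - 0.0790749| < 5e-8 ∧
      IsClassRadius classSR classK3 R ∧
      IsExtremalAt classSR classK3 R extremalF3) ∧
    -- (9) reverse lemniscate: a radius for which no sharpness is claimed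
    (∃ R : ℝ,
      IsLeastPosRoot
        (fun r =>
          (1 - r ^ 4) * √((1 - r ^ 4) ^ 2 - ((√2 - 1) - (√2 + 1) * r ^ 4) ^ 2) =
            (2 * r ^ 3 + 2 * r ^ 2 + 2 * r) ^ 2 + (1 - r ^ 4) ^ 2 -
              ((√2 - 1) - (√2 + 1) * r ^ 4) ^ 2) R ∧
      |R - 0.125145| < 5e-7 ∧
      DilatesInto classSRL classK3 R) := by
  exact ⟨fun f hf z hz => norm_starQuot_sub_le hf hz, fun _ _ h => radius_classSOrder h,
    radius_classSL, radius_classSP, radius_classSE, radius_classSC, radius_classSMoon,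
    radius_classSSin, radius_classSR, radius_classSRL⟩
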